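/- **Model.** Let $K,n,L\ge 1$ and $M\ge 2$ be integers and $J=\log_2 M$. Among $K$ users a random set $\mathcal K_a\subseteq[K]$, of arbitrary known law, is active; $\mathrm K_a=|\mathcal K_a|$ and $P_{\mathrm K_a}(k)=\mathbb P[\mathrm K_a=k]$. Each active user $k$ sends a message $W_k$ uniform on $[M]$, using a common codebook $\mathbf x_1,\dots,\mathbf x_M\in\mathbb C^n$. The $l$-th of the $L$ receive antennas observes $\mathbf y_l=\sum_{k\in\mathcal K_a}h_{k,l}\mathbf x_{W_k}+\mathbf z_l$, where the $h_{k,l}$ are i.i.d. $\mathcal{CN}(0,1)$ and the $\mathbf z_l$ are i.i.d. $\mathcal{CN}(\mathbf 0,\mathbf I_n)$; $\mathbf Y=[\mathbf y_1,\dots,\mathbf y_L]$. **Codes.** For each $P>0$ fix a probability law $\mu_P$ on $\mathbb C$ with mean $0$ and variance $P$. An ensemble code of power $P$ consists of common randomness $U$ revealed to the transmitters and to the receiver; a codebook that is a function of $U$ and whose $nM$ entries are i.i.d. with law $\mu_P$; and a decoder that knows $\mathrm K_a$ and outputs from $(\mathrm K_a,U,\mathbf Y)$ a list $\hat{\mathcal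 W}\subseteq[M]$ whose size, at most $K$, is a function of $\mathrm K_a$. The active set, the messages, $U$, the fading and the noise are independent. With $\mathcal W=\{W_k:k\in\mathcal K_a\}$, put $$P_{\rm MD}=\mathbb E\Big[1[\mathrm K_a\ge1]\frac1{\mathrm K_a}\sum_{k\in\mathcal K_a}1[W_k\notin\hat{\mathcal W}]\Big],\qquad P_{\rm FA}=\mathbb E\Big[1[|\hat{\mathcal W}|\ge1]\frac1{|\hat{\mathcal W}|}\sum_{w\in\hat{\mathcal W}}1[w\notin\mathcal W]\Big].$$ Let $E_b^*$ be the infimum of $nP/J$ over all $P>0$ for which there is an ensemble code of power $P$ with $P_{\rm MD}\le\epsilon_{\rm MD}$ and $P_{\rm FA}\le\epsilon_{\rm FA}$ (with $\inf\emptyset=+\infty$). **Theorem.** If $\epsilon_{\rm MD}\le\frac{M}{1+M}$, then $E_b^*\ge\inf_P\frac{nP}{J}$, where the infimum is over all $P>0$ such that for every $S\subseteq\{1,\dots,K\}$ there are integers $\hat K_a\in\{1,\dots,K\}$, one for each $K_a\in S$, with $$\big(\mathbb P[\mathrm K_a\in S]-\epsilon_{\rm MD}\big)J-h_2(\epsilon_{\rm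 MD})-\sum_{K_a\in S}P_{\mathrm K_a}(K_a)\log_2\hat K_a\le\sum_{K_a\in S}P_{\mathrm K_a}(K_a)\left(\frac{nL\log_2(1+K_aP)}{K_a}-\frac{L\big(1-\binom{K_a}{2}/M\big)\,\mathbb E\big[\log_2|\mathbf I_n+\mathbf X_{K_a}\mathbf X_{K_a}^H|\big]}{K_a}\right)$$ and $$\sum_{K_a\in S}P_{\mathrm K_a}(K_a)\max\Big\{\frac{\hat K_a-K_a}{\hat K_a},0\Big\}\le\epsilon_{\rm FA}.$$ Here $h_2(p)=-p\log_2p-(1-p)\log_2(1-p)$ with $0\log_20=0$, $|\cdot|$ of a matrix is the determinant, and $\mathbf X_{K_a}\in\mathbb C^{n\times K_a}$ has i.i.d. entries with law $\mu_P$. -/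

import Mathlib

open MeasureTheory ProbabilityTheory

universe u

noncomputable section

/-- The binary entropy function in bits; `Real.logb 2 0 = 0` gives the convention `0 log₂ 0 = 0`. -/
def h2 (p : ℝ) : ℝ :=
  -p * Real.logb 2 p - (1 - p) * Real.logb 2 (1 - p)

/-- The circularly symmetric complex Gaussian law `CN(0,1)`: real and imaginary parts are
independent with law `N(0,1/2)`. -/
def stdComplexGaussian : Measure ℂ :=
  ((gaussianReal 0 (1 / 2)).prod (gaussianReal 0 (1 / 2))).map Complex.measurableEquivRealProd.symm

/-- The law of an `a × b` array of complex numbers with i.i.d. entries of law `μ`. -/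
def iidArray (a b : ℕ) (μ : Measure ℂ) : Measure (Fin a → Fin b → ℂ) :=
  Measure.pi fun _ => Measure.pi fun _ => μ

/-- `μ` is a probability law on `ℂ` with mean `0` and variance `P`. -/
structure IsCenteredLaw (μ : Measure ℂ) (P : ℝ) : Prop where
  prob : IsProbabilityMeasure μ
  memLp : MemLp (fun z : ℂ => z) 2 μ
  mean : ∫ z, z ∂μ = 0
  variance : ∫ z, ‖z‖ ^ 2 ∂μ = P

/-- The signal received by the `L` antennas in `n` channel uses when the set of active users is
`A`, user `k` holds the message `w k`, the codebook is `x` (with codewords `x m`), the fading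
coefficients are `H` and the noise is `Z`: column `l` is `∑_{k ∈ A} h_{k,l} x_{w k} + z_l`. -/
def received {K n L M : ℕ} (x : Fin M → Fin n → ℂ) (A : Finset (Fin K)) (w : Fin K → Fin M)
    (H : Fin K → Fin L → ℂ) (Z : Fin n → Fin L → ℂ) : Fin n → Fin L → ℂ :=
  fun i l => (∑ k ∈ A, H k l * x (w k) i) + Z i l

/-- The set of transmitted messages. -/
def transmitted {K M : ℕ} (A : Finset (Fin K)) (w : Fin K → Fin M) : Finset (Fin M) :=
  A.image w

/-- A random-access code with a common random codebook.  The common randomness `U`, of law `law`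
on `𝒰`, is revealed to the transmitters and to the receiver; `enc U m` is the codeword of the
message `m`, and the entries of the codebook are i.i.d. with law `μ`.  The receiver knows the
number `k` of active users and outputs the list `dec k U Y`, whose size `listSize k`
is a function of `k`. -/
structure EnsembleCode (K n L M : ℕ) (μ : Measure ℂ) where
  𝒰 : Type u
  mU : MeasurableSpace 𝒰
  law : Measure 𝒰
  prob : IsProbabilityMeasure law
  enc : 𝒰 → Fin M → Fin n → ℂ
  measurable_enc : Measurable enc
  iid_enc : law.map enc = iidArray M n μ
  dec : ℕ → 𝒰 → (Fin n → Fin L → ℂ) → Finset (Fin M)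
  measurable_dec : ∀ (k : ℕ) (s : Finset (Fin M)),
    MeasurableSet {p : 𝒰 × (Fin n → Fin L → ℂ) | dec k p.1 p.2 = s}
  listSize : ℕ → ℕ
  listSize_le : ∀ k, listSize k ≤ K
  card_dec : ∀ k U Y, (dec k U Y).card = listSize k

namespace EnsembleCode

variable {K n L M : ℕ} {μ : Measure ℂ}

attribute [instance] EnsembleCode.mU EnsembleCode.prob

/-- The expectation of a function of the active set, of the messages and of the decoded list.
The active set has law `act`, the messages are independent and uniform on `Fin M`, the fading
coefficients and the noise are i.i.d. `CN(0,1)`, and the active set, the messages, the common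
randomness, the fading and the noise are independent. -/
def expectation (c : EnsembleCode.{u} K n L M μ) (act : PMF (Finset (Fin K)))
    (F : Finset (Fin K) → (Fin K → Fin M) → Finset (Fin M) → ℝ) : ℝ :=
  ∑ A : Finset (Fin K), (act A).toReal *
    ((1 / (M : ℝ) ^ K) * ∑ w : Fin K → Fin M,
      ∫ ω : c.𝒰 × (Fin K → Fin L → ℂ) × (Fin n → Fin L → ℂ),
        F A w (c.dec A.card ω.1 (received (c.enc ω.1) A w ω.2.1 ω.2.2))
        ∂(c.law.prod ((iidArray K L stdComplexGaussian).prod (iidArray n L stdComplexGaussian))))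

/-- The per-user probability of misdetection. -/
def PMD (c : EnsembleCode.{u} K n L M μ) (act : PMF (Finset (Fin K))) : ℝ :=
  c.expectation act fun A w D =>
    if 1 ≤ A.card then
      1 / (A.card : ℝ) * ∑ k ∈ A, (if w k ∉ D then 1 else 0)
    else 0

/-- The per-user probability of false alarm. -/
def PFA (c : EnsembleCode.{u} K n L M μ) (act : PMF (Finset (Fin K))) : ℝ :=
  c.expectation act fun A w D =>
    if 1 ≤ D.card then
      1 / (D.card : ℝ) * ∑ m ∈ D, (if m ∉ transmitted A w then 1 else 0)
    else 0

end EnsembleCode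

/-- The minimum energy-per-bit `inf n P / J`, `J = log₂ M`, over all powers `P > 0` for which some
code whose codebook has i.i.d. entries of law `μ P` meets both error constraints
(`⊤` if there is no such `P`). -/
def minEnergyPerBit (K n L M : ℕ) (act : PMF (Finset (Fin K))) (μ : ℝ → Measure ℂ)
    (εMD εFA : ℝ) : EReal :=
  sInf ((fun P : ℝ => ((n * P / Real.logb 2 M : ℝ) : EReal)) ''
    {P : ℝ | 0 < P ∧ ∃ c : EnsembleCode.{u} K n L M (μ P), c.PMD act ≤ εMD ∧ c.PFA act ≤ εFA})

/-- The probability that exactly `k` users are active. -/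
def kaProb {K : ℕ} (act : PMF (Finset (Fin K))) (k : ℕ) : ℝ :=
  ∑ A : Finset (Fin K) with A.card = k, (act A).toReal

/-- `𝔼 log₂ |I_n + X Xᴴ|` for an `n × k` matrix `X` with i.i.d. entries of law `μ`. -/
def expLogDet (n k : ℕ) (μ : Measure ℂ) : ℝ :=
  ∫ X : Fin n → Fin k → ℂ,
    Real.logb 2 (1 + Matrix.of X * (Matrix.of X).conjTranspose).det.re ∂(iidArray n k μ)

/-- The two constraints on the power `P`, for codebook entries of law `μ`, the set `S` of numbers
of active users and the list sizes `Khat`. -/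
def FanoConstraint {K : ℕ} (n L M : ℕ) (act : PMF (Finset (Fin K))) (μ : Measure ℂ)
    (εMD εFA P : ℝ) (S : Finset ℕ) (Khat : ℕ → ℕ) : Prop :=
  ((∑ k ∈ S, kaProb act k) - εMD) * Real.logb 2 M - h2 εMD
      - ∑ k ∈ S, kaProb act k * Real.logb 2 (Khat k)
    ≤ ∑ k ∈ S, kaProb act k *
        ((n : ℝ) * L * Real.logb 2 (1 + k * P) / k
          - L * (1 - (k.choose 2 : ℝ) / M) * expLogDet n k μ / k)
  ∧ ∑ k ∈ S, kaProb act k * max (((Khat k : ℝ) - k) / Khat k) 0 ≤ εFA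

end

open scoped ComplexConjugate Matrix

/-! ### The complex Gaussian law -/

/-! This is Fano's inequality combined with a Gaussian bound on mutual information, with both
packaged as one change of measure, so no entropy or mutual information is ever defined. Fix the
active set `A`, with `k` users. The decoded list is given a score, a sum over the active users: `log
ε` for a missed user and `log ((1 - ε) M / s)` for a found one, where `s` bounds the list size. If
the received signal is replaced by a reference signal independent of the messages, the exponential
of the score has mean at most one (`sum_exp_score_le`). By the Donsker–Varadhan principle, the true
mean of the score is then at most the relative entropy between the true and the reference laws.

The reference is white Gaussian noise of variance `1 + kP` per entry. Given the codebook and the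
messages, the output is `X H + Z`, which has the law of `B G` with `B Bᴴ = I + X Xᴴ`
(`map_leftMul_add_eq`). The relative entropy is therefore explicit: a log-determinant, plus a trace
term that cancels on average for this variance (`integral_leftMul_add_le`,
`EnsembleCode.condExpectation_score_le`). When the active messages are distinct, `X` has i.i.d.
columns. Collisions have probability at most `(k choose 2) / M`, and there `log |I + X Xᴴ| ≥ 0`
suffices (`le_average_logDet_userMatrix`).

The mean score is affine in the misdetection probability. Dividing by `k` and averaging over the
active sets with a common `ε` gives the first constraint (`sum_fano_le_sum_score`). The second is a
count: a list longer than `k` must contain false alarms. Both hold with `Khat` the list size of the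
code itself, raised to 1 if it is 0. -/

theorem stdComplexGaussian_eq_withDensity :
    stdComplexGaussian =
      volume.withDensity fun z => ENNReal.ofReal (Real.pi⁻¹ * Real.exp (-‖z‖ ^ 2)) := by
  have h12 : (1 / 2 : NNReal) ≠ 0 := by norm_num
  have hm : Measurable fun z : ℂ => ENNReal.ofReal (Real.pi⁻¹ * Real.exp (-‖z‖ ^ 2)) := by
    fun_prop
  rw [stdComplexGaussian, gaussianReal_of_var_ne_zero _ h12,
    prod_withDensity (measurable_gaussianPDF _ _) (measurable_gaussianPDF _ _),
    ← Measure.volume_eq_prod]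
  ext s hs
  rw [MeasurableEquiv.map_apply, withDensity_apply _ hs,
    withDensity_apply _ (Complex.measurableEquivRealProd.symm.measurable hs),
    ← (Complex.volume_preserving_equiv_real_prod.symm).setLIntegral_comp_preimage hs hm]
  refine lintegral_congr fun p => ?_
  rw [gaussianPDF, gaussianPDF, ← ENNReal.ofReal_mul (gaussianPDFReal_nonneg _ _ _)]
  congr 1
  have h1 : (√(2 * Real.pi * ((1 / 2 : NNReal) : ℝ)))⁻¹ * (√(2 * Real.pi * ((1 / 2 : NNReal) : ℝ)))⁻¹
      = Real.pi⁻¹ := by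
    rw [← mul_inv, Real.mul_self_sqrt (by positivity)]
    push_cast
    congr 1
    ring
  have h2 : ‖Complex.measurableEquivRealProd.symm p‖ ^ 2 = p.1 ^ 2 + p.2 ^ 2 := by
    rw [← Complex.normSq_eq_norm_sq, Complex.normSq_apply]
    simp [Complex.measurableEquivRealProd]
    ring
  rw [h2, gaussianPDFReal, gaussianPDFReal, ← h1, mul_mul_mul_comm, ← Real.exp_add]
  congr 2
  push_cast
  ring

instance isProbabilityMeasure_stdComplexGaussian : IsProbabilityMeasure stdComplexGaussian :=
  Measure.isProbabilityMeasure_map (by fun_prop)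

theorem integral_stdComplexGaussian {E : Type*} [NormedAddCommGroup E] [NormedSpace ℝ E]
    (f : ℂ → E) :
    ∫ z, f z ∂stdComplexGaussian =
      ∫ p : ℝ × ℝ, f ⟨p.1, p.2⟩ ∂((gaussianReal 0 (1 / 2)).prod (gaussianReal 0 (1 / 2))) := by
  rw [stdComplexGaussian, integral_map_equiv]
  rfl

/-- Real and imaginary parts separate by independence; the factor `1/4` is half the variance `1/2`
of each. -/
theorem integral_exp_stdComplexGaussian (t : ℂ) :
    ∫ z, Complex.exp (((conj t * z).re : ℝ) * Complex.I) ∂stdComplexGaussian =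
      Complex.exp (-((‖t‖ ^ 2 / 4 : ℝ) : ℂ)) := by
  have h (s : ℝ) : ∫ x, Complex.exp ((s : ℂ) * x * Complex.I) ∂(gaussianReal 0 (1 / 2)) =
      Complex.exp (-((s ^ 2 / 4 : ℝ) : ℂ)) := by
    rw [← charFun_apply_real, charFun_gaussianReal]
    congr 1
    push_cast
    ring
  rw [integral_stdComplexGaussian]
  have h3 (p : ℝ × ℝ) : Complex.exp (((conj t * (⟨p.1, p.2⟩ : ℂ)).re : ℝ) * Complex.I) =
      Complex.exp ((t.re : ℂ) * p.1 * Complex.I) * Complex.exp ((t.im : ℂ) * p.2 * Complex.I) := by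
    rw [← Complex.exp_add]
    congr 1
    simp
    ring
  simp_rw [h3]
  rw [integral_prod_mul (fun x : ℝ => Complex.exp ((t.re : ℂ) * x * Complex.I))
    (fun x : ℝ => Complex.exp ((t.im : ℂ) * x * Complex.I)), h, h, ← Complex.exp_add]
  congr 1
  rw [← Complex.normSq_eq_norm_sq, Complex.normSq_apply]
  push_cast
  ring

theorem isCenteredLaw_stdComplexGaussian : IsCenteredLaw stdComplexGaussian 1 := by
  set γ := gaussianReal 0 (1 / 2)
  have hL : MemLp (id : ℝ → ℝ) 2 γ := memLp_id_gaussianReal 2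
  have hsq : ∫ x, x ^ 2 ∂γ = 1 / 2 := by
    have := variance_eq_sub hL
    rw [variance_id_gaussianReal] at this
    simpa [γ, integral_id_gaussianReal] using this.symm
  have h1 : MemLp (fun p : ℝ × ℝ => p.1) 2 (γ.prod γ) := hL.comp_fst γ
  have h2 : MemLp (fun p : ℝ × ℝ => p.2) 2 (γ.prod γ) := hL.comp_snd γ
  have hmem : MemLp (fun p : ℝ × ℝ => (⟨p.1, p.2⟩ : ℂ)) 2 (γ.prod γ) := by
    have hr := h1.ofReal (K := ℂ)
    have hi := (h2.ofReal (K := ℂ)).mul_const Complex.I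
    refine (hr.add hi).ae_eq (.of_forall fun p => ?_)
    apply Complex.ext <;> simp
  have hmem' : MemLp (fun z : ℂ => z) 2 stdComplexGaussian := by
    rw [stdComplexGaussian, MeasurableEquiv.memLp_map_measure_iff]
    exact hmem
  refine ⟨inferInstance, hmem', ?_, ?_⟩
  · have hI : Integrable (fun z : ℂ => z) stdComplexGaussian := hmem'.integrable one_le_two
    apply Complex.ext
    · have := (Complex.reCLM.integral_comp_comm hI).symm
      simp only [Complex.reCLM_apply] at this
      rw [this, integral_stdComplexGaussian]
      simp only
      rw [integral_fun_fst (fun x : ℝ => x)]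
      simp [integral_id_gaussianReal]
    · have := (Complex.imCLM.integral_comp_comm hI).symm
      simp only [Complex.imCLM_apply] at this
      rw [this, integral_stdComplexGaussian]
      simp only
      rw [integral_fun_snd (fun x : ℝ => x)]
      simp [integral_id_gaussianReal]
  · rw [integral_stdComplexGaussian]
    have h4 (p : ℝ × ℝ) : ‖(⟨p.1, p.2⟩ : ℂ)‖ ^ 2 = p.1 ^ 2 + p.2 ^ 2 := by
      rw [← Complex.normSq_eq_norm_sq, Complex.normSq_apply]
      ring
    simp_rw [h4]
    rw [integral_add h1.integrable_sq h2.integrable_sq, integral_fun_fst (fun x : ℝ => x ^ 2),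
      integral_fun_snd (fun x : ℝ => x ^ 2)]
    change _ • (∫ x, x ^ 2 ∂γ) + _ • (∫ x, x ^ 2 ∂γ) = 1
    rw [hsq]
    simp
    norm_num

/-! ### Arrays with independent entries -/

/-- It is enough to compare the two measures on boxes, where the indicator of the box factors over
the coordinates and Fubini applies. -/
theorem MeasureTheory.Measure.pi_withDensity_ofReal {ι : Type*} [Fintype ι] {α : ι → Type*}
    [∀ i, MeasurableSpace (α i)] (μ : ∀ i, Measure (α i)) [∀ i, SigmaFinite (μ i)]
    (f : ∀ i, α i → ℝ) (hf : ∀ i, Integrable (f i) (μ i)) (h0 : ∀ i x, 0 ≤ f i x) :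
    Measure.pi (fun i => (μ i).withDensity fun x => ENNReal.ofReal (f i x)) =
      (Measure.pi μ).withDensity fun x => ENNReal.ofReal (∏ i, f i (x i)) := by
  have (i : ι) : IsFiniteMeasure ((μ i).withDensity fun x => ENNReal.ofReal (f i x)) :=
    isFiniteMeasure_withDensity_ofReal (hf i).2
  refine Measure.pi_eq fun s hs => ?_
  rw [withDensity_apply _ (MeasurableSet.univ_pi hs),
    ← ofReal_integral_eq_lintegral_ofReal (Integrable.fintype_prod_dep hf).integrableOn
      (.of_forall fun x => Finset.prod_nonneg fun i _ => h0 i _),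
    ← integral_indicator (MeasurableSet.univ_pi hs)]
  have h1 : (Set.univ.pi s).indicator (fun x => ∏ i, f i (x i)) =
      fun x => ∏ i, (s i).indicator (f i) (x i) := by
    ext x
    by_cases hx : x ∈ Set.univ.pi s
    · rw [Set.indicator_of_mem hx]
      exact Finset.prod_congr rfl fun i _ => (Set.indicator_of_mem (hx i trivial) _).symm
    · rw [Set.indicator_of_notMem hx]
      obtain ⟨i, hi⟩ : ∃ i, x i ∉ s i := by simpa using hx
      exact (Finset.prod_eq_zero (Finset.mem_univ i) (Set.indicator_of_notMem hi _)).symm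
  rw [h1, integral_fintype_prod_eq_prod, ENNReal.ofReal_prod_of_nonneg]
  · refine Finset.prod_congr rfl fun i _ => ?_
    rw [withDensity_apply _ (hs i), integral_indicator (hs i),
      ofReal_integral_eq_lintegral_ofReal (hf i).integrableOn (.of_forall fun x => h0 i x)]
  · exact fun i _ => integral_nonneg fun x => Set.indicator_nonneg (fun y _ => h0 i y) x

section iidArray

variable {a b : ℕ} {ν : Measure ℂ} [IsProbabilityMeasure ν]

instance isProbabilityMeasure_iidArray : IsProbabilityMeasure (iidArray a b ν) := by
  unfold iidArray
  infer_instance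

theorem measurePreserving_iidArray_apply (i : Fin a) (j : Fin b) :
    MeasurePreserving (fun y : Fin a → Fin b → ℂ => y i j) (iidArray a b ν) ν :=
  (measurePreserving_eval (fun _ : Fin b => ν) j).comp
    (measurePreserving_eval (fun _ : Fin a => Measure.pi fun _ : Fin b => ν) i)

theorem integral_prod_iidArray (f : Fin a → Fin b → ℂ → ℂ) :
    ∫ y, ∏ i, ∏ j, f i j (y i j) ∂iidArray a b ν = ∏ i, ∏ j, ∫ z, f i j z ∂ν := by
  rw [iidArray, integral_fintype_prod_eq_prod
    (fun i (r : Fin b → ℂ) => ∏ j, f i j (r j))]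
  exact Finset.prod_congr rfl fun i _ => integral_fintype_prod_eq_prod _

/-- Codewords are rows of the codebook but columns of the channel matrix. Both iterated products are
curried forms of one product over pairs of indices. -/
theorem iidArray_map_swap :
    (iidArray a b ν).map (fun y j i => y i j) = iidArray b a ν := by
  have h (c d : ℕ) : iidArray c d ν =
      (Measure.pi fun _ : Fin c × Fin d => ν).map (MeasurableEquiv.curry _ _ _) := by
    have := Measure.infinitePi_map_curry (fun (_ : Fin c) (_ : Fin d) => ν)
    simp only [Measure.infinitePi_eq_pi] at this
    exact this.symm
  rw [h a b, h b a, ← Measure.pi_map_piCongrLeft (Equiv.prodComm (Fin a) (Fin b)) (fun _ => ν),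
    Measure.map_map (by fun_prop) (by fun_prop), Measure.map_map (by fun_prop) (by fun_prop)]
  rfl

theorem iidArray_map_comp {c : ℕ} {e : Fin c → Fin a} (he : Function.Injective e) :
    (iidArray a b ν).map (fun y j => y (e j)) = iidArray c b ν := by
  have hi : iIndepFun (fun i (y : Fin a → Fin b → ℂ) => y i) (iidArray a b ν) :=
    iIndepFun_pi (X := fun _ => id) fun _ => aemeasurable_id
  rw [(iIndepFun_iff_map_fun_eq_pi_map (fun j => (measurable_pi_apply _).aemeasurable)).1 (hi.precomp he), iidArray]
  congr 1
  ext1 j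
  exact (measurePreserving_eval (fun _ : Fin a => Measure.pi fun _ : Fin b => ν) (e j)).map_eq

theorem integrable_normSq_iidArray {P : ℝ} (hν : IsCenteredLaw ν P) (i : Fin a) (j : Fin b) :
    Integrable (fun y : Fin a → Fin b → ℂ => ‖y i j‖ ^ 2) (iidArray a b ν) :=
  (measurePreserving_iidArray_apply i j).integrable_comp_of_integrable
    (hν.memLp.integrable_norm_pow two_ne_zero)

theorem integral_normSq_iidArray {P : ℝ} (hν : IsCenteredLaw ν P) (i : Fin a) (j : Fin b) :
    ∫ y : Fin a → Fin b → ℂ, ‖y i j‖ ^ 2 ∂iidArray a b ν = P := by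
  have h := measurePreserving_iidArray_apply i j (a := a) (b := b) (ν := ν)
  rw [← hν.variance, ← integral_map (f := fun z : ℂ => ‖z‖ ^ 2) h.measurable.aemeasurable
    (by fun_prop), h.map_eq]

end iidArray

/-! ### Linear images of complex Gaussian arrays -/

/-- Multiplication of an array on the left by the matrix `C`, as a linear map. -/
def leftMul {n p : ℕ} (L : ℕ) (C : Matrix (Fin n) (Fin p) ℂ) :
    (Fin p → Fin L → ℂ) →ₗ[ℂ] (Fin n → Fin L → ℂ) where
  toFun y i l := ∑ m, C i m * y m l
  map_add' y z := by
    ext i l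
    simp [mul_add, Finset.sum_add_distrib]
  map_smul' c y := by
    ext i l
    simp [Finset.mul_sum, mul_left_comm]

section leftMul

variable {n p L : ℕ}

theorem leftMul_apply (C : Matrix (Fin n) (Fin p) ℂ) (y : Fin p → Fin L → ℂ) (i : Fin n)
    (l : Fin L) : leftMul L C y i l = ∑ m, C i m * y m l := rfl

theorem measurable_leftMul (C : Matrix (Fin n) (Fin p) ℂ) : Measurable (leftMul L C) := by
  simp_rw [measurable_pi_iff, leftMul_apply]
  fun_prop

theorem det_leftMul (C : Matrix (Fin n) (Fin n) ℂ) :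
    LinearMap.det (leftMul L C) = C.det ^ L := by
  -- Indexed by antenna first, the map is `L` separate copies of `C`, whence the power `L`.
  let e : (Fin n → Fin L → ℂ) ≃ₗ[ℂ] (Fin L → Fin n → ℂ) :=
    { toFun := fun y l i => y i l
      invFun := fun y i l => y l i
      map_add' := fun _ _ => rfl
      map_smul' := fun _ _ => rfl
      left_inv := fun _ => rfl
      right_inv := fun _ => rfl }
  have h : (e : (Fin n → Fin L → ℂ) →ₗ[ℂ] _) ∘ₗ leftMul L C ∘ₗ (e.symm : _ →ₗ[ℂ] _) =
      LinearMap.pi fun l : Fin L => (Matrix.toLin' C).comp (LinearMap.proj l) := by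
    refine LinearMap.ext fun y => ?_
    ext l i
    simp [e, leftMul_apply, Matrix.mulVec, dotProduct]
  rw [← LinearMap.det_conj (leftMul L C) e, h, LinearMap.det_pi]
  simp

/-- The real inner product `∑ re (conj t * y)` of two complex arrays. -/
def arrayInner (t y : Fin n → Fin L → ℂ) : ℝ := ∑ i, ∑ l, (conj (t i l) * y i l).re

/-- Characteristic functions determine finite measures once the pairing separates points. Here it
does, because pairing `y` with itself gives its squared norm. -/
theorem Measure.ext_of_integral_exp_arrayInner {ν₁ ν₂ : Measure (Fin n → Fin L → ℂ)}
    [IsFiniteMeasure ν₁] [IsFiniteMeasure ν₂]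
    (h : ∀ t, ∫ y, Complex.exp (arrayInner t y * Complex.I) ∂ν₁ =
      ∫ y, Complex.exp (arrayInner t y * Complex.I) ∂ν₂) : ν₁ = ν₂ := by
  let B : (Fin n → Fin L → ℂ) →ₗ[ℝ] (Fin n → Fin L → ℂ) →ₗ[ℝ] ℝ :=
    LinearMap.mk₂ ℝ (fun y t => arrayInner t y)
      (fun y y' t => by simp only [arrayInner, Pi.add_apply, mul_add, Complex.add_re,
        Finset.sum_add_distrib])
      (fun c y t => by
        simp only [arrayInner, Pi.smul_apply, Complex.real_smul, smul_eq_mul, Finset.mul_sum]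
        refine Finset.sum_congr rfl fun i _ => Finset.sum_congr rfl fun l _ => ?_
        rw [mul_left_comm, Complex.re_ofReal_mul])
      (fun y t t' => by simp only [arrayInner, Pi.add_apply, map_add, add_mul, Complex.add_re,
        Finset.sum_add_distrib])
      (fun c y t => by
        simp only [arrayInner, Pi.smul_apply, Complex.real_smul, smul_eq_mul, Finset.mul_sum]
        refine Finset.sum_congr rfl fun i _ => Finset.sum_congr rfl fun l _ => ?_
        rw [map_mul, Complex.conj_ofReal, mul_assoc, Complex.re_ofReal_mul])
  have hB (y t : Fin n → Fin L → ℂ) : B y t = arrayInner t y := rfl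
  have hc : Continuous fun q : (Fin n → Fin L → ℂ) × (Fin n → Fin L → ℂ) => B q.1 q.2 := by
    simp_rw [hB, arrayInner]
    fun_prop
  refine ext_of_integral_char_eq (L := B) (e := Real.probChar) Real.continuous_probChar
    Real.probChar_ne_one ?_ hc fun t => ?_
  · intro y hy h0
    obtain ⟨i, hi⟩ := Function.ne_iff.1 hy
    obtain ⟨l, hl⟩ := Function.ne_iff.1 hi
    have h1 : arrayInner y y = 0 := by rw [← hB, h0]; rfl
    have h2 (i : Fin n) (l : Fin L) : (conj (y i l) * y i l).re = Complex.normSq (y i l) := by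
      rw [mul_comm, Complex.mul_conj, Complex.ofReal_re]
    simp_rw [arrayInner, h2] at h1
    have h3 := (Finset.sum_eq_zero_iff_of_nonneg fun i _ =>
      Finset.sum_nonneg fun l _ => Complex.normSq_nonneg _).1 h1 i (Finset.mem_univ i)
    have h4 := (Finset.sum_eq_zero_iff_of_nonneg fun l _ => Complex.normSq_nonneg _).1 h3 l
      (Finset.mem_univ l)
    exact hl (Complex.normSq_eq_zero.1 h4)
  · simpa [BoundedContinuousFunction.char_apply, Real.probChar_apply, hB] using h t

theorem arrayInner_leftMul (C : Matrix (Fin n) (Fin p) ℂ) (t : Fin n → Fin L → ℂ)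
    (y : Fin p → Fin L → ℂ) : arrayInner t (leftMul L C y) = arrayInner (leftMul L Cᴴ t) y := by
  simp_rw [arrayInner, leftMul_apply, map_sum, Finset.mul_sum, Finset.sum_mul, Complex.re_sum]
  rw [Finset.sum_comm]
  conv_rhs => rw [Finset.sum_comm]
  refine Finset.sum_congr rfl fun l _ => ?_
  rw [Finset.sum_comm]
  refine Finset.sum_congr rfl fun m _ => Finset.sum_congr rfl fun i _ => ?_
  simp only [Matrix.conjTranspose_apply, RCLike.star_def, map_mul, Complex.conj_conj]
  rw [← mul_assoc, mul_comm (C i m)]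

theorem leftMul_leftMul {q : ℕ} (C : Matrix (Fin n) (Fin p) ℂ) (D : Matrix (Fin p) (Fin q) ℂ)
    (y : Fin q → Fin L → ℂ) : leftMul L C (leftMul L D y) = leftMul L (C * D) y := by
  ext i l
  simp_rw [leftMul_apply, Matrix.mul_apply, Finset.mul_sum, Finset.sum_mul]
  rw [Finset.sum_comm]
  simp_rw [mul_assoc]

theorem leftMul_one (y : Fin n → Fin L → ℂ) : leftMul L 1 y = y := by
  ext i l
  simp [leftMul_apply, Matrix.one_apply]

theorem integral_exp_arrayInner (t : Fin n → Fin L → ℂ) :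
    ∫ y, Complex.exp (arrayInner t y * Complex.I) ∂iidArray n L stdComplexGaussian =
      Complex.exp (-((arrayInner t t / 4 : ℝ) : ℂ)) := by
  have h (y : Fin n → Fin L → ℂ) : Complex.exp (arrayInner t y * Complex.I) =
      ∏ i, ∏ l, Complex.exp (((conj (t i l) * y i l).re : ℝ) * Complex.I) := by
    simp_rw [← Complex.exp_sum, arrayInner]
    push_cast
    simp_rw [Finset.sum_mul]
  simp_rw [h]
  rw [integral_prod_iidArray
    fun i l z => Complex.exp (((conj (t i l) * z).re : ℝ) * Complex.I)]
  simp_rw [integral_exp_stdComplexGaussian, ← Complex.exp_sum, arrayInner]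
  congr 1
  push_cast
  simp_rw [Finset.sum_div, Finset.sum_neg_distrib]
  congr 1
  refine Finset.sum_congr rfl fun i _ => Finset.sum_congr rfl fun l _ => ?_
  rw [mul_comm (conj (t i l)), Complex.mul_conj, Complex.ofReal_re, Complex.normSq_eq_norm_sq]
  push_cast
  rfl

/-- If `B Bᴴ = 1 + X Xᴴ` then `X H + Z` and `B G` have the same law, for independent standard
complex Gaussian arrays. -/
theorem map_leftMul_add_eq (X : Matrix (Fin n) (Fin p) ℂ) (B : Matrix (Fin n) (Fin n) ℂ)
    (hB : 1 + X * Xᴴ = B * Bᴴ) :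
    ((iidArray p L stdComplexGaussian).prod (iidArray n L stdComplexGaussian)).map
        (fun q => leftMul L X q.1 + q.2) =
      (iidArray n L stdComplexGaussian).map (leftMul L B) := by
  have hX := measurable_leftMul (L := L) X
  have hBm := measurable_leftMul (L := L) B
  have hm (t : Fin n → Fin L → ℂ) :
      Continuous fun y => Complex.exp (arrayInner t y * Complex.I) := by
    unfold arrayInner
    fun_prop
  have h1 : Measurable fun q : (Fin p → Fin L → ℂ) × (Fin n → Fin L → ℂ) =>
      leftMul L X q.1 + q.2 := by fun_prop
  have := Measure.isProbabilityMeasure_map (μ := (iidArray p L stdComplexGaussian).prod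
    (iidArray n L stdComplexGaussian)) h1.aemeasurable
  have := Measure.isProbabilityMeasure_map (μ := iidArray n L stdComplexGaussian) hBm.aemeasurable
  refine Measure.ext_of_integral_exp_arrayInner fun t => ?_
  have hadd (t y z : Fin n → Fin L → ℂ) :
      arrayInner t (y + z) = arrayInner t y + arrayInner t z := by
    simp only [arrayInner, Pi.add_apply, mul_add, Complex.add_re, Finset.sum_add_distrib]
  rw [integral_map h1.aemeasurable (hm t).aestronglyMeasurable,
    integral_map hBm.aemeasurable (hm t).aestronglyMeasurable]
  simp_rw [hadd, arrayInner_leftMul]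
  push_cast
  simp_rw [add_mul, Complex.exp_add]
  rw [integral_prod_mul
    (fun y : Fin p → Fin L → ℂ => Complex.exp (arrayInner (leftMul L Xᴴ t) y * Complex.I))
    (fun y : Fin n → Fin L → ℂ => Complex.exp (arrayInner t y * Complex.I)),
    integral_exp_arrayInner, integral_exp_arrayInner, integral_exp_arrayInner,
    ← Complex.exp_add]
  congr 1
  -- Both exponents are now quadratic forms in `t`, with matrices `X Xᴴ` plus the identity on one
  -- side and `B Bᴴ` on the other.
  rw [← arrayInner_leftMul, ← arrayInner_leftMul, leftMul_leftMul, leftMul_leftMul, ← hB]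
  have h2 : leftMul L (1 + X * Xᴴ) t = t + leftMul L (X * Xᴴ) t := by
    conv_rhs => enter [1]; rw [← leftMul_one t]
    ext i l
    simp [leftMul_apply, add_mul, Finset.sum_add_distrib]
  rw [h2, hadd]
  push_cast
  ring

end leftMul

/-! ### Second moments of linear images of i.i.d. arrays. -/

section SecondMoment

variable {a b : ℕ} {ν : Measure ℂ} [IsProbabilityMeasure ν] {P : ℝ}

theorem memLp_iidArray_apply (hν : IsCenteredLaw ν P) (i : Fin a) (j : Fin b) :
    MemLp (fun y : Fin a → Fin b → ℂ => y i j) 2 (iidArray a b ν) :=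
  hν.memLp.comp_measurePreserving (measurePreserving_iidArray_apply i j)

theorem integrable_conj_mul_iidArray (hν : IsCenteredLaw ν P) (i i' : Fin a) (j : Fin b) :
    Integrable (fun y : Fin a → Fin b → ℂ => conj (y i j) * y i' j) (iidArray a b ν) :=
  (memLp_iidArray_apply hν i j).star.integrable_mul (memLp_iidArray_apply hν i' j)

theorem integral_conj_mul_iidArray (hν : IsCenteredLaw ν P) (i i' : Fin a) (j : Fin b) :
    ∫ y : Fin a → Fin b → ℂ, conj (y i j) * y i' j ∂iidArray a b ν =
      if i = i' then (P : ℂ) else 0 := by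
  split_ifs with h
  · subst h
    rw [← integral_normSq_iidArray hν i j, ← integral_complex_ofReal]
    congr with y
    rw [mul_comm, Complex.mul_conj, Complex.normSq_eq_norm_sq]
  · have hi : iIndepFun (fun i (y : Fin a → Fin b → ℂ) => y i) (iidArray a b ν) :=
      iIndepFun_pi (X := fun _ => id) fun _ => aemeasurable_id
    have hi2 : IndepFun (fun y : Fin a → Fin b → ℂ => conj (y i j)) (fun y => y i' j)
        (iidArray a b ν) :=
      (hi.indepFun h).comp (φ := fun r : Fin b → ℂ => conj (r j)) (ψ := fun r : Fin b → ℂ => r j)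
        (Complex.continuous_conj.comp (continuous_apply j)).measurable (by fun_prop)
    have h0 : ∫ y : Fin a → Fin b → ℂ, y i' j ∂iidArray a b ν = 0 := by
      have hp := measurePreserving_iidArray_apply i' j (a := a) (b := b) (ν := ν)
      rw [← integral_map (f := fun z : ℂ => z) hp.measurable.aemeasurable
        (by fun_prop), hp.map_eq, hν.mean]
    rw [hi2.integral_fun_mul_eq_mul_integral (memLp_iidArray_apply hν i j).star.1
      (memLp_iidArray_apply hν i' j).1, h0, mul_zero]

theorem integrable_normSq_sum_iidArray (hν : IsCenteredLaw ν P) (c : Fin a → ℂ) (j : Fin b) :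
    Integrable (fun y : Fin a → Fin b → ℂ => ‖∑ m, c m * y m j‖ ^ 2) (iidArray a b ν) :=
  (memLp_finsetSum _ fun m _ => (memLp_iidArray_apply hν m j).const_mul (c m)).integrable_norm_pow
    two_ne_zero

theorem integral_normSq_sum_iidArray (hν : IsCenteredLaw ν P) (c : Fin a → ℂ) (j : Fin b) :
    ∫ y : Fin a → Fin b → ℂ, ‖∑ m, c m * y m j‖ ^ 2 ∂iidArray a b ν = P * ∑ m, ‖c m‖ ^ 2 := by
  have h (y : Fin a → Fin b → ℂ) : ((‖∑ m, c m * y m j‖ ^ 2 : ℝ) : ℂ) =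
      ∑ m, ∑ m', conj (c m) * c m' * (conj (y m j) * y m' j) := by
    rw [← Complex.normSq_eq_norm_sq, ← Complex.mul_conj, mul_comm, map_sum, Finset.sum_mul_sum]
    refine Finset.sum_congr rfl fun m _ => Finset.sum_congr rfl fun m' _ => ?_
    rw [map_mul]
    ring
  apply Complex.ofReal_injective
  rw [← integral_complex_ofReal]
  simp_rw [h]
  rw [integral_finsetSum _ fun m _ => integrable_finsetSum _ fun m' _ =>
    (integrable_conj_mul_iidArray hν m m' j).const_mul _]
  simp_rw [integral_finsetSum Finset.univ fun m' _ =>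
    (integrable_conj_mul_iidArray hν _ m' j).const_mul _, integral_const_mul,
    integral_conj_mul_iidArray hν, mul_ite, mul_zero, Finset.sum_ite_eq, Finset.mem_univ, if_true]
  push_cast
  rw [Finset.mul_sum]
  refine Finset.sum_congr rfl fun m _ => ?_
  rw [mul_comm (conj (c m)), Complex.mul_conj, Complex.normSq_eq_norm_sq, mul_comm]
  push_cast
  rfl

end SecondMoment

/-- The squared Frobenius norm of an array. -/
noncomputable def sqNorm {n L : ℕ} (y : Fin n → Fin L → ℂ) : ℝ := ∑ i, ∑ l, ‖y i l‖ ^ 2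

section sqNorm

variable {n p L : ℕ} {ν : Measure ℂ} [IsProbabilityMeasure ν] {P : ℝ}

theorem continuous_sqNorm : Continuous (sqNorm : (Fin n → Fin L → ℂ) → ℝ) := by
  unfold sqNorm
  fun_prop

theorem integrable_sqNorm_leftMul (hν : IsCenteredLaw ν P) (C : Matrix (Fin n) (Fin p) ℂ) :
    Integrable (fun y => sqNorm (leftMul L C y)) (iidArray p L ν) :=
  integrable_finsetSum _ fun i _ => integrable_finsetSum _ fun l _ =>
    integrable_normSq_sum_iidArray hν (C i) l

theorem integral_sqNorm_leftMul (hν : IsCenteredLaw ν P) (C : Matrix (Fin n) (Fin p) ℂ) :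
    ∫ y, sqNorm (leftMul L C y) ∂iidArray p L ν = P * L * sqNorm C := by
  have h := fun i l => integrable_normSq_sum_iidArray (b := L) hν (C i) l
  simp_rw [sqNorm, leftMul_apply]
  rw [integral_finsetSum _ fun i _ => integrable_finsetSum _ fun l _ => h i l]
  simp_rw [integral_finsetSum Finset.univ fun l _ => h _ l, integral_normSq_sum_iidArray hν]
  simp only [Finset.sum_const, Finset.card_univ, Fintype.card_fin, nsmul_eq_mul,
    Finset.mul_sum]
  exact Finset.sum_congr rfl fun i _ => Finset.sum_congr rfl fun j _ => by ring

theorem sqNorm_one : sqNorm (1 : Matrix (Fin n) (Fin n) ℂ) = n := by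
  have h (i j : Fin n) : ‖(1 : Matrix (Fin n) (Fin n) ℂ) i j‖ ^ 2 = if i = j then 1 else 0 := by
    by_cases h : i = j <;> simp [Matrix.one_apply, h]
  simp [sqNorm, h]

theorem integrable_sqNorm (hν : IsCenteredLaw ν P) :
    Integrable (sqNorm : (Fin n → Fin L → ℂ) → ℝ) (iidArray n L ν) := by
  have := integrable_sqNorm_leftMul (L := L) hν (1 : Matrix (Fin n) (Fin n) ℂ)
  simpa only [leftMul_one] using this

theorem integral_sqNorm (hν : IsCenteredLaw ν P) :
    ∫ y : Fin n → Fin L → ℂ, sqNorm y ∂iidArray n L ν = P * L * n := by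
  have := integral_sqNorm_leftMul (L := L) hν (1 : Matrix (Fin n) (Fin n) ℂ)
  simpa only [leftMul_one, sqNorm_one] using this

end sqNorm

/-! ### Likelihood ratios between linear images of Gaussian arrays. -/

section ChangeOfVariables

variable {n L : ℕ}

/-- The normalising constant is left unspecified since it cancels from every likelihood ratio. -/
theorem exists_iidArray_eq_withDensity (n L : ℕ) : ∃ c : ℝ, 0 < c ∧
    iidArray n L stdComplexGaussian =
      volume.withDensity fun y => ENNReal.ofReal (c * Real.exp (-sqNorm y)) := by
  set f : ℂ → ℝ := fun z => Real.pi⁻¹ * Real.exp (-‖z‖ ^ 2)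
  have h0 (z : ℂ) : 0 ≤ f z := by positivity
  have hf : Integrable f := by
    refine ⟨by fun_prop, ?_⟩
    have : (∫⁻ z, ENNReal.ofReal (f z)) = 1 := by
      rw [← setLIntegral_univ, ← withDensity_apply _ MeasurableSet.univ,
        ← stdComplexGaussian_eq_withDensity, measure_univ]
    rw [hasFiniteIntegral_iff_ofReal (.of_forall h0), this]
    exact ENNReal.one_lt_top
  refine ⟨∏ _ : Fin n, ∏ _ : Fin L, Real.pi⁻¹, by positivity, ?_⟩
  rw [iidArray, stdComplexGaussian_eq_withDensity, Measure.pi_withDensity_ofReal _ _ (fun _ => hf)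
    (fun _ => h0), Measure.pi_withDensity_ofReal _ _
      (fun _ => Integrable.fintype_prod_dep fun _ => hf)
      (fun _ _ => Finset.prod_nonneg fun _ _ => h0 _)]
  simp_rw [f, Finset.prod_mul_distrib, ← Real.exp_sum, Finset.sum_neg_distrib]
  rfl

/-- The law of a standard complex Gaussian array `G` as the image under `C` of the law of `G`
weighted by a likelihood ratio. -/
theorem map_leftMul_withDensity (C : Matrix (Fin n) (Fin n) ℂ) (hC : C.det ≠ 0) :
    ((iidArray n L stdComplexGaussian).withDensity fun y => ENNReal.ofReal
      (Complex.normSq C.det ^ L * Real.exp (sqNorm y - sqNorm (leftMul L C y)))).map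
        (leftMul L C) = iidArray n L stdComplexGaussian := by
  obtain ⟨c, hc, h⟩ := exists_iidArray_eq_withDensity n L
  have hs : Measurable (sqNorm : (Fin n → Fin L → ℂ) → ℝ) := continuous_sqNorm.measurable
  have hCm := measurable_leftMul (L := L) C
  have hdet : LinearMap.det ((leftMul L C).restrictScalars ℝ) = Complex.normSq C.det ^ L := by
    -- The real determinant of a complex-linear map is the squared modulus of its complex
    -- determinant.
    rw [LinearMap.det_restrictScalars, Algebra.norm_complex_apply, det_leftMul, map_pow]
  have hpos : 0 < Complex.normSq C.det ^ L := pow_pos (Complex.normSq_pos.2 hC) L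
  have : (volume : Measure (Fin L → ℂ)).IsAddHaarMeasure := Measure.pi.isAddHaarMeasure _
  have : (volume : Measure (Fin n → Fin L → ℂ)).IsAddHaarMeasure := Measure.pi.isAddHaarMeasure _
  have hvol : Measure.map (leftMul L C) volume =
      ENNReal.ofReal (Complex.normSq C.det ^ L)⁻¹ • (volume : Measure (Fin n → Fin L → ℂ)) := by
    have := Measure.map_linearMap_addHaar_eq_smul_addHaar
      (volume : Measure (Fin n → Fin L → ℂ)) (f := (leftMul L C).restrictScalars ℝ)
      (by rw [hdet]; exact hpos.ne')
    rw [hdet, abs_of_pos (inv_pos.2 hpos)] at this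
    exact this
  rw [h, ← withDensity_mul _ (by fun_prop) (by fun_prop)]
  ext s hms
  rw [Measure.map_apply hCm hms, withDensity_apply _ (hCm hms), withDensity_apply _ hms]
  -- The factors `exp (±sqNorm y)` cancel, so the weighted density depends on `y` only through `C y`
  -- and the linear change of variables applies.
  have h1 (y : Fin n → Fin L → ℂ) :
      ((fun y => ENNReal.ofReal (c * Real.exp (-sqNorm y))) * (fun y => ENNReal.ofReal
        (Complex.normSq C.det ^ L * Real.exp (sqNorm y - sqNorm (leftMul L C y)))) :
          (Fin n → Fin L → ℂ) → ENNReal) y =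
      (fun z => ENNReal.ofReal (Complex.normSq C.det ^ L * (c * Real.exp (-sqNorm z))))
        (leftMul L C y) := by
    simp only [Pi.mul_apply]
    rw [← ENNReal.ofReal_mul (by positivity)]
    congr 1
    rw [mul_mul_mul_comm, ← Real.exp_add]
    ring_nf
  simp_rw [h1]
  rw [← setLIntegral_map (f := fun z => ENNReal.ofReal
    (Complex.normSq C.det ^ L * (c * Real.exp (-sqNorm z)))) hms (by fun_prop) hCm, hvol, Measure.restrict_smul,
    lintegral_smul_measure, smul_eq_mul, ← lintegral_const_mul _ (by fun_prop)]
  refine lintegral_congr fun y => ?_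
  rw [← ENNReal.ofReal_mul (by positivity), ← mul_assoc, inv_mul_cancel₀ hpos.ne', one_mul]

/-- A Donsker–Varadhan inequality for the law of `C G` relative to that of `G`. -/
theorem integral_comp_leftMul_le (C : Matrix (Fin n) (Fin n) ℂ) (hC : C.det ≠ 0)
    {g : (Fin n → Fin L → ℂ) → ℝ} (hg : Measurable g) {b : ℝ} (hb : ∀ y, |g y| ≤ b) :
    ∫ y, g (leftMul L C y) ∂iidArray n L stdComplexGaussian ≤
      L * sqNorm C - n * L - L * Real.log (Complex.normSq C.det)
        + ∫ y, Real.exp (g y) ∂iidArray n L stdComplexGaussian - 1 := by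
  set γ := iidArray n L stdComplexGaussian with hγ
  set r : (Fin n → Fin L → ℂ) → ℝ := fun y =>
    Complex.normSq C.det ^ L * Real.exp (sqNorm y - sqNorm (leftMul L C y)) with hr
  have hs : Measurable (sqNorm : (Fin n → Fin L → ℂ) → ℝ) := continuous_sqNorm.measurable
  have hCm := measurable_leftMul (L := L) C
  have hpos : 0 < Complex.normSq C.det := Complex.normSq_pos.2 hC
  have hrpos (y) : 0 < r y := mul_pos (pow_pos hpos L) (Real.exp_pos _)
  have hrm : Measurable r := by fun_prop
  have hmap : (γ.withDensity fun y => ENNReal.ofReal (r y)).map (leftMul L C) = γ :=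
    map_leftMul_withDensity C hC
  have hexp : Integrable (fun y => Real.exp (g y)) γ :=
    Integrable.of_bound (by fun_prop) (Real.exp b) (.of_forall fun y => by
      rw [Real.norm_eq_abs, Real.abs_exp]
      exact Real.exp_le_exp.2 ((le_abs_self _).trans (hb y)))
  have hint : Integrable (fun y => r y * Real.exp (g (leftMul L C y))) γ := by
    have h1 : Integrable (fun y => Real.exp (g (leftMul L C y)))
        (γ.withDensity fun y => ENNReal.ofReal (r y)) := by
      rw [← hmap] at hexp
      exact hexp.comp_measurable hCm
    rw [integrable_withDensity_iff_integrable_smul' (by fun_prop)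
      (.of_forall fun _ => ENNReal.ofReal_lt_top)] at h1
    simpa only [ENNReal.toReal_ofReal (hrpos _).le, smul_eq_mul] using h1
  have heq : ∫ y, Real.exp (g y) ∂γ = ∫ y, r y * Real.exp (g (leftMul L C y)) ∂γ := by
    conv_lhs => rw [← hmap]
    rw [integral_map hCm.aemeasurable (by fun_prop),
      integral_withDensity_eq_integral_toReal_smul (by fun_prop)
        (.of_forall fun _ => ENNReal.ofReal_lt_top)]
    simp only [ENNReal.toReal_ofReal (hrpos _).le, smul_eq_mul]
  have hCG := isCenteredLaw_stdComplexGaussian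
  have i1 : Integrable (fun y => sqNorm (leftMul L C y)) γ := integrable_sqNorm_leftMul hCG C
  have i2 : Integrable (sqNorm : (Fin n → Fin L → ℂ) → ℝ) γ := integrable_sqNorm hCG
  -- This is `log x ≤ x - 1` at `x = r y * exp (g (C y))`. On integration, `heq` turns the mean of
  -- `x` into that of `exp ∘ g`, and `-log r` gives the relative entropy.
  have key (y : Fin n → Fin L → ℂ) : g (leftMul L C y) ≤
      sqNorm (leftMul L C y) - sqNorm y + r y * Real.exp (g (leftMul L C y))
        - (L * Real.log (Complex.normSq C.det) + 1) := by
    have := Real.log_le_sub_one_of_pos (mul_pos (hrpos y) (Real.exp_pos (g (leftMul L C y))))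
    rw [Real.log_mul (hrpos y).ne' (Real.exp_pos _).ne', Real.log_exp, hr,
      Real.log_mul (pow_pos hpos L).ne' (Real.exp_pos _).ne', Real.log_exp, Real.log_pow] at this
    linarith
  calc ∫ y, g (leftMul L C y) ∂γ
      ≤ ∫ y, (sqNorm (leftMul L C y) - sqNorm y + r y * Real.exp (g (leftMul L C y))
        - (L * Real.log (Complex.normSq C.det) + 1)) ∂γ :=
        integral_mono (Integrable.of_bound (hg.comp hCm).aestronglyMeasurable b
          (.of_forall fun y => hb _))
          (((i1.sub i2).add hint).sub (integrable_const _)) key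
    _ = _ := by
        rw [integral_sub (by exact (i1.sub i2).add hint) (integrable_const _),
          integral_add (by exact i1.sub i2) hint, integral_sub i1 i2, ← heq, integral_const,
          hγ, integral_sqNorm_leftMul hCG, integral_sqNorm hCG]
        simp
        ring

end ChangeOfVariables

/-! ### The log-determinant and the output law for a fixed channel matrix. -/

/-- The natural logarithm of `|I + X Xᴴ|`. -/
noncomputable def logDet {n p : ℕ} (X : Matrix (Fin n) (Fin p) ℂ) : ℝ :=
  Real.log (1 + X * Xᴴ).det.re

section logDet

open scoped ComplexOrder

variable {n p L : ℕ}

theorem posSemidef_one_add_mul_conjTranspose (X : Matrix (Fin n) (Fin p) ℂ) :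
    (1 + X * Xᴴ).PosSemidef :=
  Matrix.PosSemidef.one.add (Matrix.posSemidef_self_mul_conjTranspose X)

/-- Evaluating the quadratic form at a unit eigenvector shows each eigenvalue to be 1 plus a
nonnegative number. The resulting sign of `logDet` is what allows message collisions to be discarded
later. -/
theorem one_le_det_one_add_mul_conjTranspose (X : Matrix (Fin n) (Fin p) ℂ) :
    1 ≤ (1 + X * Xᴴ).det.re := by
  have hA := (posSemidef_one_add_mul_conjTranspose X).1
  have h1 (i : Fin n) : 1 ≤ hA.eigenvalues i := by
    rw [hA.eigenvalues_eq, Matrix.add_mulVec, dotProduct_add, map_add, Matrix.one_mulVec]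
    have h2 : RCLike.re (star (hA.eigenvectorBasis i).ofLp ⬝ᵥ (hA.eigenvectorBasis i).ofLp) =
        (1 : ℝ) := by
      rw [dotProduct_comm, ← EuclideanSpace.inner_eq_star_dotProduct, inner_self_eq_norm_sq,
        hA.eigenvectorBasis.orthonormal.1 i, one_pow]
    have h3 := (Matrix.posSemidef_self_mul_conjTranspose X).re_dotProduct_nonneg
      (hA.eigenvectorBasis i).ofLp
    rw [h2]
    exact le_add_of_nonneg_right h3
  have h4 : (1 + X * Xᴴ).det = ((∏ i, hA.eigenvalues i : ℝ) : ℂ) := by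
    rw [hA.det_eq_prod_eigenvalues, Complex.ofReal_prod]
    rfl
  rw [h4, Complex.ofReal_re]
  simpa using Finset.prod_le_prod (s := Finset.univ) (f := fun _ => (1 : ℝ))
    (fun _ _ => zero_le_one) fun i _ => h1 i

theorem logDet_nonneg (X : Matrix (Fin n) (Fin p) ℂ) : 0 ≤ logDet X :=
  Real.log_nonneg (one_le_det_one_add_mul_conjTranspose X)

theorem sqNorm_eq_trace (X : Matrix (Fin n) (Fin p) ℂ) : sqNorm X = (X * Xᴴ).trace.re := by
  simp only [sqNorm, Matrix.trace, Matrix.diag_apply, Matrix.mul_apply,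
    Matrix.conjTranspose_apply, RCLike.star_def, Complex.mul_conj, Complex.re_sum,
    Complex.ofReal_re, Complex.normSq_eq_norm_sq]

open scoped MatrixOrder Matrix.Norms.L2Operator in
theorem exists_one_add_eq_mul_conjTranspose (X : Matrix (Fin n) (Fin p) ℂ) :
    ∃ B : Matrix (Fin n) (Fin n) ℂ, 1 + X * Xᴴ = B * Bᴴ :=
  CStarAlgebra.nonneg_iff_eq_mul_star_self.1 (posSemidef_one_add_mul_conjTranspose X).nonneg

/-- A bound on the expectation of a function of `X H + Z`, obtained by comparing the law of
`X H + Z` with that of a Gaussian array of variance `s`. -/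
theorem integral_leftMul_add_le (X : Matrix (Fin n) (Fin p) ℂ) {s : ℝ} (hs : 0 < s)
    {g : (Fin n → Fin L → ℂ) → ℝ} (hg : Measurable g) {b : ℝ} (hb : ∀ y, |g y| ≤ b) :
    ∫ q, g (leftMul L X q.1 + q.2)
        ∂((iidArray p L stdComplexGaussian).prod (iidArray n L stdComplexGaussian)) ≤
      n * L * Real.log s - L * logDet X + L * ((n + sqNorm X) / s) - n * L
        + ∫ y, Real.exp (g (fun i l => (√s : ℂ) * y i l)) ∂iidArray n L stdComplexGaussian
        - 1 := by
  obtain ⟨B, hB⟩ := exists_one_add_eq_mul_conjTranspose X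
  have hX := measurable_leftMul (L := L) X
  have hBm := measurable_leftMul (L := L) B
  have h1 : Measurable fun q : (Fin p → Fin L → ℂ) × (Fin n → Fin L → ℂ) =>
      leftMul L X q.1 + q.2 := by fun_prop
  have hdet : (1 + X * Xᴴ).det.re = Complex.normSq B.det := by
    rw [hB, Matrix.det_mul, Matrix.det_conjTranspose, RCLike.star_def, Complex.mul_conj,
      Complex.ofReal_re]
  have hdet1 : 1 ≤ Complex.normSq B.det := hdet ▸ one_le_det_one_add_mul_conjTranspose X
  have hsB : sqNorm B = n + sqNorm X := by
    rw [sqNorm_eq_trace, ← hB, Matrix.trace_add, Complex.add_re, ← sqNorm_eq_trace]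
    simp
  have hr : 0 < √s := Real.sqrt_pos.2 hs
  have hr' : (√s : ℂ) ≠ 0 := by exact_mod_cast hr.ne'
  -- Comparing `B G` with `√s G` amounts to comparing `C G` with `G` for the test function `y ↦ g
  -- (√s y)`.
  set C : Matrix (Fin n) (Fin n) ℂ := ((√s : ℂ)⁻¹) • B with hCdef
  have hBC (y : Fin n → Fin L → ℂ) :
      leftMul L B y = fun i l => (√s : ℂ) * leftMul L C y i l := by
    ext i l
    simp only [leftMul_apply, Finset.mul_sum, C, Matrix.smul_apply, smul_eq_mul]
    refine Finset.sum_congr rfl fun m _ => ?_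
    field_simp
  have hsC : sqNorm C = (n + sqNorm X) / s := by
    rw [← hsB]
    simp only [sqNorm, C, Matrix.smul_apply, smul_eq_mul, norm_mul, mul_pow, Finset.sum_div]
    refine Finset.sum_congr rfl fun i _ => Finset.sum_congr rfl fun l _ => ?_
    rw [norm_inv, Complex.norm_real, Real.norm_eq_abs, abs_of_pos hr, inv_pow,
      Real.sq_sqrt hs.le, div_eq_inv_mul]
  have hCn : Complex.normSq C.det = s⁻¹ ^ n * Complex.normSq B.det := by
    rw [hCdef, Matrix.det_smul, map_mul, map_pow, map_inv₀, Complex.normSq_ofReal,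
      Real.mul_self_sqrt hs.le, Fintype.card_fin]
  have hC0 : C.det ≠ 0 := by
    rw [← Complex.normSq_pos, hCn]
    positivity
  have hg' : Measurable fun y : Fin n → Fin L → ℂ => g (fun i l => (√s : ℂ) * y i l) :=
    hg.comp (by fun_prop)
  have main := integral_comp_leftMul_le C hC0 hg' fun y => hb _
  have hlog : Real.log (Complex.normSq C.det) = -(n * Real.log s) + logDet X := by
    rw [hCn, logDet, hdet, Real.log_mul (by positivity) (by positivity), Real.log_pow,
      Real.log_inv]
    ring
  have heq : ∫ q, g (leftMul L X q.1 + q.2)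
        ∂((iidArray p L stdComplexGaussian).prod (iidArray n L stdComplexGaussian)) =
      ∫ y, g (fun i l => (√s : ℂ) * leftMul L C y i l) ∂iidArray n L stdComplexGaussian := by
    rw [← integral_map h1.aemeasurable hg.aestronglyMeasurable, map_leftMul_add_eq X B hB,
      integral_map hBm.aemeasurable hg.aestronglyMeasurable]
    simp_rw [hBC]
  rw [heq]
  rw [hlog, hsC] at main
  linarith

/-- With one antenna, unit reference variance and a zero test function, the preceding bound says
that relative entropy is nonnegative. This supplies an integrable majorant for `logDet`. -/
theorem logDet_le_sqNorm (X : Matrix (Fin n) (Fin p) ℂ) : logDet X ≤ sqNorm X := by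
  have h := integral_leftMul_add_le (L := 1) X one_pos (g := fun _ => 0) measurable_const
    (b := 0) (by simp)
  simp at h
  linarith

theorem measurable_logDet {n p : ℕ} :
    Measurable fun X : Fin n → Fin p → ℂ => logDet (Matrix.of X) := by
  have : Continuous fun X : Fin n → Fin p → ℂ => (1 + Matrix.of X * (Matrix.of X)ᴴ).det.re := by
    fun_prop
  exact Real.measurable_log.comp this.measurable

theorem expLogDet_eq (n k : ℕ) (μ : Measure ℂ) :
    expLogDet n k μ = (∫ X : Fin n → Fin k → ℂ, logDet (Matrix.of X) ∂iidArray n k μ) /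
      Real.log 2 := by
  rw [expLogDet, ← integral_div]
  rfl

end logDet

/-! ### The random matrix of active codewords. -/

/-- The matrix whose `k`-th column is the codeword of user `k`, or zero if the user is not
active. -/
def userMatrix {K n M : ℕ} (A : Finset (Fin K)) (w : Fin K → Fin M) (x : Fin M → Fin n → ℂ) :
    Matrix (Fin n) (Fin K) ℂ :=
  Matrix.of fun i k => if k ∈ A then x (w k) i else 0

section userMatrix

variable {K n L M : ℕ} (A : Finset (Fin K)) (w : Fin K → Fin M)

theorem received_eq (x : Fin M → Fin n → ℂ) (H : Fin K → Fin L → ℂ) (Z : Fin n → Fin L → ℂ) :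
    received x A w H Z = leftMul L (userMatrix A w x) H + Z := by
  ext i l
  simp [received, leftMul_apply, userMatrix, mul_comm]

theorem sqNorm_userMatrix (x : Fin M → Fin n → ℂ) :
    sqNorm (userMatrix A w x) = ∑ i, ∑ k ∈ A, ‖x (w k) i‖ ^ 2 := by
  refine Finset.sum_congr rfl fun i _ => ?_
  rw [← Finset.sum_subset (Finset.subset_univ A) fun k _ hk => by simp [userMatrix, hk]]
  exact Finset.sum_congr rfl fun k hk => by simp [userMatrix, hk]

variable {ν : Measure ℂ} [IsProbabilityMeasure ν] {P : ℝ}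

theorem integrable_sqNorm_userMatrix (hν : IsCenteredLaw ν P) :
    Integrable (fun x => sqNorm (userMatrix A w x)) (iidArray M n ν) := by
  simp_rw [sqNorm_userMatrix]
  exact integrable_finsetSum _ fun i _ => integrable_finsetSum _ fun k _ =>
    integrable_normSq_iidArray hν _ _

theorem integral_sqNorm_userMatrix (hν : IsCenteredLaw ν P) :
    ∫ x, sqNorm (userMatrix A w x) ∂iidArray M n ν = n * (A.card * P) := by
  simp_rw [sqNorm_userMatrix]
  rw [integral_finsetSum _ fun i _ => integrable_finsetSum _ fun k _ =>
    integrable_normSq_iidArray hν _ _]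
  simp_rw [integral_finsetSum A fun k _ => integrable_normSq_iidArray hν _ _,
    integral_normSq_iidArray hν]
  simp

theorem integrable_logDet_userMatrix (hν : IsCenteredLaw ν P) :
    Integrable (fun x => logDet (userMatrix A w x)) (iidArray M n ν) := by
  have hm : Measurable fun x : Fin M → Fin n → ℂ => logDet (userMatrix A w x) := by
    have hX : Measurable fun (x : Fin M → Fin n → ℂ) (i : Fin n) (k : Fin K) =>
        if k ∈ A then x (w k) i else 0 := by
      refine measurable_pi_iff.2 fun i => measurable_pi_iff.2 fun k => ?_
      split_ifs
      · fun_prop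
      · exact measurable_const
    exact measurable_logDet.comp hX
  refine (integrable_sqNorm_userMatrix A w hν).mono' hm.aestronglyMeasurable
    (.of_forall fun x => ?_)
  rw [Real.norm_eq_abs, abs_of_nonneg (logDet_nonneg _)]
  exact logDet_le_sqNorm _

/-- If the active users send distinct messages, their codewords form an i.i.d. array. -/
theorem integral_logDet_userMatrix_of_injOn {A : Finset (Fin K)} {w : Fin K → Fin M}
    (hw : Set.InjOn w A) :
    ∫ x, logDet (userMatrix A w x) ∂iidArray M n ν =
      ∫ X : Fin n → Fin A.card → ℂ, logDet (Matrix.of X) ∂iidArray n A.card ν := by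
  set e : Fin A.card ≃ A := A.equivFin.symm
  have he : Function.Injective fun j => w (e j) := fun i j hij =>
    e.injective (Subtype.ext (hw (e i).2 (e j).2 hij))
  -- Zero columns contribute nothing to `X Xᴴ`, so they can be dropped and the remaining columns
  -- relabelled.
  have h (x : Fin M → Fin n → ℂ) : logDet (userMatrix A w x) =
      logDet (Matrix.of fun i j => x (w (e j)) i) := by
    unfold logDet
    congr 4
    ext i i'
    simp only [Matrix.mul_apply, userMatrix, Matrix.of_apply, Matrix.conjTranspose_apply]
    rw [e.sum_comp fun a : A => x (w a) i * star (x (w a) i'), Finset.sum_coe_sort A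
      fun a => x (w a) i * star (x (w a) i'),
      ← Finset.sum_subset (Finset.subset_univ A) fun k _ hk => by simp [hk]]
    exact Finset.sum_congr rfl fun k hk => by simp [hk]
  have hs : Measurable fun (y : Fin A.card → Fin n → ℂ) (j : Fin n) (i : Fin A.card) => y i j := by
    fun_prop
  have hc : Measurable fun (y : Fin M → Fin n → ℂ) (j : Fin A.card) => y (w (e j)) := by fun_prop
  simp_rw [h]
  rw [← iidArray_map_swap (a := A.card) (b := n), ← iidArray_map_comp (b := n) he,
    integral_map hs.aemeasurable measurable_logDet.aestronglyMeasurable,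
    integral_map (f := fun y : Fin A.card → Fin n → ℂ => logDet (Matrix.of fun i j => y j i))
      hc.aemeasurable (measurable_logDet.comp hs).aestronglyMeasurable]

end userMatrix

/-! ### Message collisions, and the score of a list independent of the messages. -/

section counting

variable {K M : ℕ}

/-- Overwriting coordinate `i` by an arbitrary message is injective on such vectors, since the lost
value survives at coordinate `j`. -/
theorem card_filter_apply_eq_le {i j : Fin K} (hij : i ≠ j) :
    M * (Finset.univ.filter fun w : Fin K → Fin M => w i = w j).card ≤ M ^ K := by
  have h := Finset.card_le_card_of_injOn (s := (Finset.univ : Finset (Fin M)) ×ˢ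
    (Finset.univ.filter fun w : Fin K → Fin M => w i = w j))
    (t := (Finset.univ : Finset (Fin K → Fin M))) (fun q => Function.update q.2 i q.1)
    (fun _ _ => Finset.mem_univ _) ?_
  · simpa using h
  · rintro ⟨m, w⟩ h1 ⟨m', w'⟩ h2 h
    simp only [Finset.coe_product, Set.mem_prod, Finset.mem_coe, Finset.mem_filter,
      Finset.mem_univ, true_and] at h1 h2 h
    have hk (k : Fin K) (hki : k ≠ i) : w k = w' k := by
      simpa [Function.update_of_ne hki] using congrFun h k
    have hm : m = m' := by simpa using congrFun h i
    rw [Prod.mk.injEq]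
    refine ⟨hm, funext fun k => ?_⟩
    by_cases hki : k = i
    · rw [hki, h1, h2, hk j hij.symm]
    · exact hk k hki

open Classical in
/-- The union bound for the number of message vectors with a collision in `A`. -/
theorem card_filter_not_injOn_le (A : Finset (Fin K)) :
    M * (Finset.univ.filter fun w : Fin K → Fin M => ¬ Set.InjOn w A).card ≤
      A.card.choose 2 * M ^ K := by
  set N := Finset.univ.filter fun w : Fin K → Fin M => ¬ Set.InjOn w A
  -- Ordered pairs are used, so each colliding vector is counted at least twice; this matches `k (k
  -- - 1) = 2 (k choose 2)`.
  have h1 : 2 * N.card ≤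
      ∑ q ∈ A.offDiag, (Finset.univ.filter fun w : Fin K → Fin M => w q.1 = w q.2).card := by
    simp_rw [Finset.card_filter]
    rw [Finset.sum_comm, mul_comm, ← smul_eq_mul, ← Finset.sum_const]
    refine (Finset.sum_le_sum fun w hw => ?_).trans
      (Finset.sum_le_sum_of_subset (Finset.subset_univ N))
    have hw' : ¬ Set.InjOn w A := (Finset.mem_filter.1 hw).2
    simp only [Set.InjOn, not_forall] at hw'
    obtain ⟨i, hi, j, hj, hij, hne⟩ := hw'
    have hsub : {(i, j), (j, i)} ⊆ A.offDiag := by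
      intro q hq
      simp only [Finset.mem_insert, Finset.mem_singleton] at hq
      rcases hq with rfl | rfl
      · exact Finset.mem_offDiag.2 ⟨hi, hj, hne⟩
      · exact Finset.mem_offDiag.2 ⟨hj, hi, Ne.symm hne⟩
    refine le_trans ?_ (Finset.sum_le_sum_of_subset hsub)
    rw [Finset.sum_pair (by simp [hne])]
    simp [hij]
  have h2 : 2 * (M * N.card) ≤ 2 * (A.card.choose 2 * M ^ K) := by
    calc 2 * (M * N.card) = M * (2 * N.card) := by ring
      _ ≤ ∑ q ∈ A.offDiag, M ^ K := by
        refine (Nat.mul_le_mul_left M h1).trans ?_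
        rw [Finset.mul_sum]
        exact Finset.sum_le_sum fun q hq => card_filter_apply_eq_le (Finset.mem_offDiag.1 hq).2.2
      _ = 2 * (A.card.choose 2 * M ^ K) := by
        rw [Finset.sum_const, smul_eq_mul, Finset.offDiag_card, Nat.choose_two_right,
          ← Nat.mul_sub_one, ← mul_assoc, Nat.mul_div_cancel' (Nat.even_mul_pred_self _).two_dvd]
  omega

-- Message vectors without a collision each contribute the same i.i.d. integral, and the others
-- contribute at least zero. Since that integral is nonnegative, the bound also holds when `1 - (k
-- choose 2) / M` is negative.
open Classical in
theorem le_average_logDet_userMatrix {n : ℕ} (hM : 1 ≤ M) (A : Finset (Fin K)) (ν : Measure ℂ)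
    [IsProbabilityMeasure ν] :
    (1 - (A.card.choose 2 : ℝ) / M) *
        ∫ X : Fin n → Fin A.card → ℂ, logDet (Matrix.of X) ∂iidArray n A.card ν ≤
      1 / (M : ℝ) ^ K *
        ∑ w : Fin K → Fin M, ∫ x, logDet (userMatrix A w x) ∂iidArray M n ν := by
  set I := ∫ X : Fin n → Fin A.card → ℂ, logDet (Matrix.of X) ∂iidArray n A.card ν
  have hI : 0 ≤ I := integral_nonneg fun X => logDet_nonneg _
  have hM0 : (0 : ℝ) < M := by exact_mod_cast hM
  set G := Finset.univ.filter fun w : Fin K → Fin M => Set.InjOn w A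
  set N := Finset.univ.filter fun w : Fin K → Fin M => ¬ Set.InjOn w A
  have hGN : G.card + N.card = M ^ K := by
    rw [Finset.card_filter_add_card_filter_not]
    simp
  have hGN' : (G.card : ℝ) = (M : ℝ) ^ K - N.card := by
    rw [← Nat.cast_pow, ← hGN]
    push_cast
    ring
  have hN : (M : ℝ) * N.card ≤ A.card.choose 2 * (M : ℝ) ^ K := by
    exact_mod_cast card_filter_not_injOn_le A
  have hsum : G.card * I ≤
      ∑ w : Fin K → Fin M, ∫ x, logDet (userMatrix A w x) ∂iidArray M n ν := by
    rw [← nsmul_eq_mul, ← Finset.sum_const]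
    refine le_trans (Finset.sum_le_sum fun w hw => ?_) (Finset.sum_le_sum_of_subset_of_nonneg
      (Finset.filter_subset (fun w : Fin K → Fin M => Set.InjOn w A) Finset.univ)
      fun w _ _ => integral_nonneg fun x => logDet_nonneg _)
    exact (integral_logDet_userMatrix_of_injOn (Finset.mem_filter.1 hw).2).ge
  have hcoef : (1 - (A.card.choose 2 : ℝ) / M) ≤ 1 / (M : ℝ) ^ K * G.card := by
    rw [hGN', mul_sub, one_div, inv_mul_cancel₀ (by positivity)]
    refine sub_le_sub_left ?_ 1
    rw [inv_mul_eq_div, div_le_div_iff₀ (by positivity) hM0, mul_comm]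
    exact hN
  calc (1 - (A.card.choose 2 : ℝ) / M) * I ≤ 1 / (M : ℝ) ^ K * G.card * I :=
        mul_le_mul_of_nonneg_right hcoef hI
    _ ≤ _ := by
        rw [mul_assoc]
        exact mul_le_mul_of_nonneg_left hsum (by positivity)

/-- The average over the messages of the exponential of the Fano score is at most one. -/
theorem sum_exp_score_le (hM : 1 ≤ M) (A : Finset (Fin K)) (D : Finset (Fin M)) {ε : ℝ}
    (h0 : 0 < ε) (h1 : ε < 1) {s : ℕ} (hs : 1 ≤ s) (hD : D.card ≤ s) :
    ∑ w : Fin K → Fin M, Real.exp (∑ k ∈ A,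
      if w k ∉ D then Real.log ε else Real.log ((1 - ε) * M / s)) ≤ (M : ℝ) ^ K := by
  have hM0 : (0 : ℝ) < M := by exact_mod_cast hM
  have hs0 : (0 : ℝ) < s := by exact_mod_cast hs
  have hε : 0 < 1 - ε := by linarith
  set v : Fin K → Fin M → ℝ := fun k m =>
    if k ∈ A then (if m ∉ D then ε else (1 - ε) * M / s) else 1
  have hv (w : Fin K → Fin M) : Real.exp (∑ k ∈ A,
      if w k ∉ D then Real.log ε else Real.log ((1 - ε) * M / s)) = ∏ k, v k (w k) := by
    rw [Real.exp_sum, ← Finset.prod_filter_mul_prod_filter_not Finset.univ (· ∈ A)]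
    have h2 : ∏ k with k ∉ A, v k (w k) = 1 :=
      Finset.prod_eq_one fun k hk => if_neg (Finset.mem_filter.1 hk).2
    rw [h2, mul_one]
    simp only [Finset.filter_mem_eq_inter, Finset.univ_inter]
    refine Finset.prod_congr rfl fun k hk => ?_
    simp only [v, hk, if_true]
    split_ifs
    · exact Real.exp_log (by positivity)
    · exact Real.exp_log h0
  simp_rw [hv]
  rw [← Fintype.piFinset_univ, Finset.sum_prod_piFinset Finset.univ v]
  -- The sum over `w` factors over the users. For an active user the missed messages give at most `ε
  -- M` and those in `D` at most `(1 - ε) M`, because `D.card ≤ s`.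
  have hle (k : Fin K) : ∑ m, v k m ≤ M := by
    by_cases hk : k ∈ A
    · simp only [v, hk, if_true]
      rw [Finset.sum_ite]
      simp only [Finset.sum_const, nsmul_eq_mul, not_not, Finset.filter_univ_mem]
      have h3 : (D.card : ℝ) * ((1 - ε) * M / s) ≤ (1 - ε) * M := by
        rw [← mul_div_assoc, div_le_iff₀ hs0, mul_comm]
        exact mul_le_mul_of_nonneg_left (by exact_mod_cast hD) (by positivity)
      have h4 : ((Finset.univ.filter fun m => m ∉ D).card : ℝ) ≤ M := by
        exact_mod_cast (Finset.card_le_univ _).trans_eq (Fintype.card_fin M)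
      nlinarith
    · simp [v, hk]
  calc ∏ k, ∑ m, v k m ≤ ∏ _k : Fin K, (M : ℝ) :=
        Finset.prod_le_prod (fun k _ => Finset.sum_nonneg fun m _ => by
          simp only [v]; split_ifs <;> positivity) fun k _ => hle k
    _ = (M : ℝ) ^ K := by simp

end counting

/-! ### The information bound for a fixed active set. -/

namespace EnsembleCode

variable {K n L M : ℕ} {μ : Measure ℂ} (c : EnsembleCode.{u} K n L M μ)

/-- The expectation of a function of the messages and of the decoded list, when the set of active
users is `A`. -/
noncomputable def condExpectation (A : Finset (Fin K))
    (F : (Fin K → Fin M) → Finset (Fin M) → ℝ) : ℝ :=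
  (1 / (M : ℝ) ^ K) * ∑ w : Fin K → Fin M,
    ∫ ω : c.𝒰 × (Fin K → Fin L → ℂ) × (Fin n → Fin L → ℂ),
      F w (c.dec A.card ω.1 (received (c.enc ω.1) A w ω.2.1 ω.2.2))
      ∂(c.law.prod ((iidArray K L stdComplexGaussian).prod (iidArray n L stdComplexGaussian)))

theorem expectation_eq (act : PMF (Finset (Fin K)))
    (F : Finset (Fin K) → (Fin K → Fin M) → Finset (Fin M) → ℝ) :
    c.expectation act F = ∑ A, (act A).toReal * c.condExpectation A (F A) := rfl

theorem measurable_comp_dec (k : ℕ) (f : Finset (Fin M) → ℝ) :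
    Measurable fun p : c.𝒰 × (Fin n → Fin L → ℂ) => f (c.dec k p.1 p.2) := by
  let _ : MeasurableSpace (Finset (Fin M)) := ⊤
  have h : Measurable fun p : c.𝒰 × (Fin n → Fin L → ℂ) => c.dec k p.1 p.2 :=
    measurable_to_countable' fun s => c.measurable_dec k s
  exact (measurable_from_top (f := f)).comp h

theorem measurable_received_enc (A : Finset (Fin K)) (w : Fin K → Fin M) :
    Measurable fun ω : c.𝒰 × (Fin K → Fin L → ℂ) × (Fin n → Fin L → ℂ) =>
      received (c.enc ω.1) A w ω.2.1 ω.2.2 := by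
  have hx (m : Fin M) (i : Fin n) : Measurable fun U => c.enc U m i :=
    (measurable_pi_apply i).comp ((measurable_pi_apply m).comp c.measurable_enc)
  unfold received
  fun_prop

theorem integrable_comp_dec (A : Finset (Fin K)) (w : Fin K → Fin M) (f : Finset (Fin M) → ℝ) :
    Integrable (fun ω : c.𝒰 × (Fin K → Fin L → ℂ) × (Fin n → Fin L → ℂ) =>
      f (c.dec A.card ω.1 (received (c.enc ω.1) A w ω.2.1 ω.2.2)))
      (c.law.prod ((iidArray K L stdComplexGaussian).prod (iidArray n L stdComplexGaussian))) := by
  refine Integrable.of_bound ((c.measurable_comp_dec A.card f).comp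
    (measurable_fst.prodMk (c.measurable_received_enc A w))).aestronglyMeasurable
    (∑ D, |f D|) (.of_forall fun ω => ?_)
  exact Finset.single_le_sum (f := fun D => |f D|) (fun D _ => abs_nonneg _) (Finset.mem_univ _)

variable {c}

theorem condExpectation_mono {A : Finset (Fin K)} {F G : (Fin K → Fin M) → Finset (Fin M) → ℝ}
    (h : ∀ w D, D.card = c.listSize A.card → F w D ≤ G w D) :
    c.condExpectation A F ≤ c.condExpectation A G :=
  mul_le_mul_of_nonneg_left (Finset.sum_le_sum fun w _ =>
    integral_mono (c.integrable_comp_dec A w (F w)) (c.integrable_comp_dec A w (G w))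
      fun _ => h w _ (c.card_dec _ _ _)) (by positivity)

theorem condExpectation_const (hM : 1 ≤ M) (A : Finset (Fin K)) (r : ℝ) :
    c.condExpectation A (fun _ _ => r) = r := by
  have hM0 : (M : ℝ) ≠ 0 := by exact_mod_cast (Nat.one_le_iff_ne_zero.1 hM)
  simp [condExpectation, hM0]

theorem condExpectation_const_add_mul (hM : 1 ≤ M) (A : Finset (Fin K)) (r t : ℝ)
    (F : (Fin K → Fin M) → Finset (Fin M) → ℝ) :
    c.condExpectation A (fun w D => r + t * F w D) = r + t * c.condExpectation A F := by
  conv_rhs => rw [← condExpectation_const (c := c) hM A r]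
  simp only [condExpectation]
  simp_rw [integral_add (integrable_const r) ((c.integrable_comp_dec A _ (F _)).const_mul t),
    integral_const_mul, Finset.sum_add_distrib, ← Finset.mul_sum]
  ring

theorem expectation_nonneg {act : PMF (Finset (Fin K))}
    {F : Finset (Fin K) → (Fin K → Fin M) → Finset (Fin M) → ℝ} (h : ∀ A w D, 0 ≤ F A w D) :
    0 ≤ c.expectation act F :=
  Finset.sum_nonneg fun A _ => mul_nonneg ENNReal.toReal_nonneg
    (mul_nonneg (by positivity) (Finset.sum_nonneg fun w _ => integral_nonneg fun _ => h A w _))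

/-- The expected Fano score is at most an upper bound on the mutual information between the
messages of the active users and the received signal. -/
theorem condExpectation_score_le [IsProbabilityMeasure μ] (hM : 1 ≤ M) {P : ℝ} (hP : 0 < P)
    (hμ : IsCenteredLaw μ P) (A : Finset (Fin K)) {ε : ℝ} (h0 : 0 < ε) (h1 : ε < 1) {s : ℕ}
    (hs : 1 ≤ s) (hc : c.listSize A.card ≤ s) :
    c.condExpectation A (fun w D => ∑ k ∈ A,
        if w k ∉ D then Real.log ε else Real.log ((1 - ε) * M / s)) ≤
      n * L * Real.log (1 + A.card * P) - L * ((1 - (A.card.choose 2 : ℝ) / M) *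
        ∫ X : Fin n → Fin A.card → ℂ, logDet (Matrix.of X) ∂iidArray n A.card μ) := by
  have hM0 : (0 : ℝ) < M := by exact_mod_cast hM
  have hMK : (0 : ℝ) < (M : ℝ) ^ K := pow_pos hM0 K
  set F : (Fin K → Fin M) → Finset (Fin M) → ℝ := fun w D => ∑ k ∈ A,
    if w k ∉ D then Real.log ε else Real.log ((1 - ε) * M / s)
  set γ := iidArray n L stdComplexGaussian with hγ
  -- The mean squared modulus of an output entry. With this reference variance the averaged trace
  -- term is exactly `n L` and cancels (`h2` below).
  set v : ℝ := 1 + A.card * P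
  have hv : 0 < v := by positivity
  have hFb (w : Fin K → Fin M) (D : Finset (Fin M)) : |F w D| ≤ ∑ D, |F w D| :=
    Finset.single_le_sum (f := fun D => |F w D|) (fun D _ => abs_nonneg _) (Finset.mem_univ _)
  have hscale : Measurable fun y : Fin n → Fin L → ℂ => fun i l => (√v : ℂ) * y i l := by fun_prop
  have hE (w : Fin K → Fin M) : Integrable (fun q : c.𝒰 × (Fin n → Fin L → ℂ) =>
      Real.exp (F w (c.dec A.card q.1 fun i l => (√v : ℂ) * q.2 i l))) (c.law.prod γ) := by
    refine Integrable.of_bound (C := Real.exp (∑ D, |F w D|)) ?_ (.of_forall fun q => ?_)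
    · exact (Real.measurable_exp.comp ((c.measurable_comp_dec A.card (F w)).comp
        (measurable_fst.prodMk (hscale.comp measurable_snd)))).aestronglyMeasurable
    · rw [Real.norm_eq_abs, Real.abs_exp]
      exact Real.exp_le_exp.2 ((le_abs_self _).trans (hFb w _))
  have hlogDet (w : Fin K → Fin M) :
      Integrable (fun U => logDet (userMatrix A w (c.enc U))) c.law := by
    have := integrable_logDet_userMatrix (n := n) A w hμ
    rw [← c.iid_enc] at this
    exact this.comp_measurable c.measurable_enc
  have hsq (w : Fin K → Fin M) :
      Integrable (fun U => sqNorm (userMatrix A w (c.enc U))) c.law := by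
    have := integrable_sqNorm_userMatrix (n := n) A w hμ
    rw [← c.iid_enc] at this
    exact this.comp_measurable c.measurable_enc
  have hlogDet' (w : Fin K → Fin M) : ∫ U, logDet (userMatrix A w (c.enc U)) ∂c.law =
      ∫ x, logDet (userMatrix A w x) ∂iidArray M n μ := by
    rw [← c.iid_enc, integral_map c.measurable_enc.aemeasurable]
    rw [c.iid_enc]
    exact (integrable_logDet_userMatrix (n := n) A w hμ).1
  have hsq' (w : Fin K → Fin M) : ∫ U, sqNorm (userMatrix A w (c.enc U)) ∂c.law =
      n * (A.card * P) := by
    rw [← integral_sqNorm_userMatrix A w hμ, ← c.iid_enc,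
      integral_map c.measurable_enc.aemeasurable]
    rw [c.iid_enc]
    exact (integrable_sqNorm_userMatrix (n := n) A w hμ).1
  -- The comparison is made for each value of the common randomness, where the codebook is
  -- deterministic, and then averaged over it.
  have hw (w : Fin K → Fin M) :
      ∫ ω : c.𝒰 × (Fin K → Fin L → ℂ) × (Fin n → Fin L → ℂ),
        F w (c.dec A.card ω.1 (received (c.enc ω.1) A w ω.2.1 ω.2.2))
        ∂(c.law.prod ((iidArray K L stdComplexGaussian).prod γ)) ≤
      n * L * Real.log v - 1 - L * (∫ x, logDet (userMatrix A w x) ∂iidArray M n μ)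
        + ∫ q, Real.exp (F w (c.dec A.card q.1 fun i l => (√v : ℂ) * q.2 i l))
          ∂(c.law.prod γ) := by
    have hI := c.integrable_comp_dec A w (F w)
    rw [integral_prod _ hI]
    have hU (U : c.𝒰) := integral_leftMul_add_le (L := L) (userMatrix A w (c.enc U)) hv
      (g := fun y => F w (c.dec A.card U y))
      ((c.measurable_comp_dec A.card (F w)).comp measurable_prodMk_left) (fun y => hFb w _)
    have i1 := (hlogDet w).const_mul (L : ℝ)
    have i2 := (((integrable_const (μ := c.law) (n : ℝ)).add (hsq w)).div_const v).const_mul (L : ℝ)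
    have i3 := (hE w).integral_prod_left
    have i4 : Integrable (fun _ : c.𝒰 => (n : ℝ) * L * Real.log v) c.law := integrable_const _
    have i5 : Integrable (fun _ : c.𝒰 => (n : ℝ) * L) c.law := integrable_const _
    have i6 : Integrable (fun _ : c.𝒰 => (1 : ℝ)) c.law := integrable_const _
    refine (integral_mono hI.integral_prod_left
      (((((i4.sub i1).add i2).sub i5).add i3).sub i6) fun U => ?_).trans_eq ?_
    · simp only [received_eq]
      exact hU U
    · rw [integral_sub' ((((i4.sub i1).add i2).sub i5).add i3) i6,
        integral_add' (((i4.sub i1).add i2).sub i5) i3, integral_sub' ((i4.sub i1).add i2) i5,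
        integral_add' (i4.sub i1) i2, integral_sub' i4 i1, integral_const_mul (L : ℝ),
        integral_const_mul (L : ℝ),
        integral_div, integral_add' (integrable_const _) (hsq w), hsq', hlogDet',
        integral_prod _ (hE w)]
      have h2 : ((n : ℝ) + n * (A.card * P)) / v = n := by
        rw [div_eq_iff hv.ne']
        ring
      simp only [integral_const, probReal_univ, one_smul, h2]
      ring
  -- Under the reference output the list does not depend on `w`, so the sum over messages can be
  -- taken first. The resulting average, at most one, absorbs the `-1` in `hw`.
  have hexp : ∑ w, ∫ q, Real.exp (F w (c.dec A.card q.1 fun i l => (√v : ℂ) * q.2 i l))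
      ∂(c.law.prod γ) ≤ (M : ℝ) ^ K := by
    rw [← integral_finsetSum _ fun w _ => hE w]
    refine (integral_mono (integrable_finsetSum _ fun w _ => hE w)
      (integrable_const ((M : ℝ) ^ K)) fun q => ?_).trans_eq (by simp)
    exact sum_exp_score_le hM A _ h0 h1 hs ((c.card_dec _ _ _).trans_le hc)
  have hld := le_average_logDet_userMatrix (n := n) hM A μ
  set S := ∑ w : Fin K → Fin M, ∫ x, logDet (userMatrix A w x) ∂iidArray M n μ
  calc c.condExpectation A F
      ≤ 1 / (M : ℝ) ^ K * ((M : ℝ) ^ K * (n * L * Real.log v - 1) - L * S + (M : ℝ) ^ K) := by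
        refine mul_le_mul_of_nonneg_left ((Finset.sum_le_sum fun w _ => hw w).trans ?_)
          (by positivity)
        rw [Finset.sum_add_distrib, Finset.sum_sub_distrib, ← Finset.mul_sum]
        simp only [Finset.sum_const, Finset.card_univ, Fintype.card_pi, Fintype.card_fin,
          Finset.prod_const, nsmul_eq_mul, Nat.cast_pow]
        linarith
    _ = n * L * Real.log v - L * (1 / (M : ℝ) ^ K * S) := by
        field_simp
        ring
    _ ≤ _ := sub_le_sub_left (mul_le_mul_of_nonneg_left hld (Nat.cast_nonneg L)) _

end EnsembleCode

/-! ### Averaging over the active set. -/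

theorem sum_kaProb_mul {K : ℕ} (act : PMF (Finset (Fin K))) (S : Finset ℕ) (f : ℕ → ℝ) :
    ∑ k ∈ S, kaProb act k * f k =
      ∑ A : Finset (Fin K) with A.card ∈ S, (act A).toReal * f A.card := by
  rw [← Finset.sum_fiberwise_of_maps_to (s := Finset.univ.filter
    fun A : Finset (Fin K) => A.card ∈ S) (t := S) (g := Finset.card)
    fun A hA => (Finset.mem_filter.1 hA).2]
  refine Finset.sum_congr rfl fun k hk => ?_
  rw [kaProb, Finset.sum_mul, Finset.filter_filter]
  refine Finset.sum_congr ?_ fun A hA => ?_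
  · ext A
    simp only [Finset.mem_filter, Finset.mem_univ, true_and]
    exact ⟨fun h => ⟨h ▸ hk, h⟩, fun h => h.2⟩
  · rw [(Finset.mem_filter.1 hA).2.2]

theorem PMF.sum_toReal_le_one {α : Type*} [Fintype α] (p : PMF α) (s : Finset α) :
    ∑ a ∈ s, (p a).toReal ≤ 1 := by
  rw [← ENNReal.toReal_sum fun a _ => p.apply_ne_top a, ← ENNReal.toReal_one]
  refine ENNReal.toReal_mono ENNReal.one_ne_top ?_
  rw [← p.tsum_coe]
  exact ENNReal.sum_le_tsum s

/-- Weighted averages of Fano inequalities with the common parameter `ε`. -/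
theorem sum_fano_le_sum_score {ι : Type*} (T : Finset ι) {p m s : ι → ℝ} {M ε : ℝ} (hM : 0 < M)
    (hp : ∀ i ∈ T, 0 ≤ p i) (hm : ∀ i ∈ T, 0 ≤ m i) (hs : ∀ i ∈ T, 1 ≤ s i)
    (hp1 : ∑ i ∈ T, p i ≤ 1) (hm1 : ∑ i ∈ T, p i * m i ≤ ε) (h0 : 0 < ε)
    (hε : ε ≤ M / (1 + M)) :
    (∑ i ∈ T, p i - ε) * Real.log M - Real.binEntropy ε - ∑ i ∈ T, p i * Real.log (s i) ≤
      ∑ i ∈ T, p i * (Real.log ((1 - ε) * M / s i)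
        + (Real.log ε - Real.log ((1 - ε) * M / s i)) * m i) := by
  have h1 : ε < 1 := hε.trans_lt ((div_lt_one (by positivity)).2 (by linarith))
  have hε1 : 0 < 1 - ε := by linarith
  -- This form of `hε` makes `log ε - log ((1 - ε) M)` nonpositive, so the average miss probability
  -- may be replaced by its upper bound `ε`.
  have hle : ε ≤ (1 - ε) * M := by
    rw [le_div_iff₀ (by positivity)] at hε
    linarith
  have hlog : Real.log ε ≤ Real.log (1 - ε) + Real.log M := by
    rw [← Real.log_mul hε1.ne' hM.ne']
    exact Real.log_le_log h0 hle
  have hneg : Real.log (1 - ε) ≤ 0 := Real.log_nonpos hε1.le (by linarith)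
  have hterm : ∑ i ∈ T, (p i * (Real.log (1 - ε) + Real.log M)
      - p i * m i * (Real.log (1 - ε) + Real.log M - Real.log ε) - p i * Real.log (s i)) ≤
      ∑ i ∈ T, p i * (Real.log ((1 - ε) * M / s i)
        + (Real.log ε - Real.log ((1 - ε) * M / s i)) * m i) := by
    refine Finset.sum_le_sum fun i hi => ?_
    have hsi : 0 < s i := zero_lt_one.trans_le (hs i hi)
    rw [Real.log_div (by positivity) hsi.ne', Real.log_mul hε1.ne' hM.ne']
    -- The dropped term `p m log s` is nonnegative: the list size is charged in full, as if no user
    -- were missed.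
    have := mul_nonneg (mul_nonneg (hp i hi) (hm i hi)) (Real.log_nonneg (hs i hi))
    linarith
  refine le_trans ?_ hterm
  rw [Finset.sum_sub_distrib, Finset.sum_sub_distrib, ← Finset.sum_mul, ← Finset.sum_mul,
    Real.binEntropy_eq_negMulLog_add_negMulLog_one_sub, Real.negMulLog, Real.negMulLog]
  have e1 := mul_nonneg (sub_nonneg.2 hm1) (sub_nonneg.2 hlog)
  -- The weights may sum to less than one; since `log (1 - ε) ≤ 0`, the full entropy term still
  -- bounds what is needed.
  have e2 := mul_nonneg_of_nonpos_of_nonpos (sub_nonpos.2 hp1) hneg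
  linarith

theorem h2_eq (p : ℝ) : h2 p = Real.binEntropy p / Real.log 2 := by
  rw [Real.binEntropy_eq_negMulLog_add_negMulLog_one_sub, h2, Real.negMulLog, Real.negMulLog,
    Real.logb, Real.logb]
  ring

/-! ### Misdetection, false alarms and the two constraints. -/

namespace EnsembleCode

variable {K n L M : ℕ} {μ : Measure ℂ} {c : EnsembleCode.{u} K n L M μ}

/-- The average probability of misdetection of the users in `A` when `A` is the set of active
users. -/
noncomputable def missProb (c : EnsembleCode.{u} K n L M μ) (A : Finset (Fin K)) : ℝ :=
  c.condExpectation A fun w D => 1 / (A.card : ℝ) * ∑ k ∈ A, if w k ∉ D then 1 else 0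

theorem missProb_nonneg (A : Finset (Fin K)) : 0 ≤ c.missProb A := by
  refine mul_nonneg (by positivity) (Finset.sum_nonneg fun w _ => integral_nonneg fun ω => ?_)
  exact mul_nonneg (by positivity) (Finset.sum_nonneg fun k _ => by split_ifs <;> simp)

theorem sum_missProb_le_PMD (act : PMF (Finset (Fin K))) {S : Finset ℕ} (hS : ∀ k ∈ S, 1 ≤ k) :
    ∑ A : Finset (Fin K) with A.card ∈ S, (act A).toReal * c.missProb A ≤ c.PMD act := by
  rw [PMD, expectation_eq]
  refine le_trans (Finset.sum_le_sum fun A hA => ?_) (Finset.sum_le_sum_of_subset_of_nonneg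
    (Finset.filter_subset (fun A : Finset (Fin K) => A.card ∈ S) Finset.univ)
    fun A _ _ => mul_nonneg ENNReal.toReal_nonneg ?_)
  · simp only [hS _ (Finset.mem_filter.1 hA).2, if_true]
    exact le_rfl
  · split_ifs
    · exact missProb_nonneg A
    · simp [condExpectation]

/-- The converse bound conditionally on the set of active users. -/
theorem score_missProb_le [IsProbabilityMeasure μ] (hM : 1 ≤ M) {P : ℝ} (hP : 0 < P)
    (hμ : IsCenteredLaw μ P) {A : Finset (Fin K)} (hA : 1 ≤ A.card) {ε : ℝ} (h0 : 0 < ε)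
    (h1 : ε < 1) {s : ℕ} (hs : 1 ≤ s) (hc : c.listSize A.card ≤ s) :
    Real.log ((1 - ε) * M / s) + (Real.log ε - Real.log ((1 - ε) * M / s)) * c.missProb A ≤
      (n * L * Real.logb 2 (1 + A.card * P) / A.card
        - L * (1 - (A.card.choose 2 : ℝ) / M) * expLogDet n A.card μ / A.card) * Real.log 2 := by
  have hk : (0 : ℝ) < A.card := by exact_mod_cast hA
  have h := condExpectation_score_le (c := c) hM hP hμ A h0 h1 hs hc
  set a := Real.log ((1 - ε) * M / s)
  -- The score is affine in the number of missed users, so its mean depends on the code only through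
  -- `missProb`.
  have hF : (fun (w : Fin K → Fin M) (D : Finset (Fin M)) =>
      ∑ k ∈ A, if w k ∉ D then Real.log ε else a) = fun w D => A.card * a +
        (A.card * (Real.log ε - a)) *
          (1 / (A.card : ℝ) * ∑ k ∈ A, if w k ∉ D then 1 else 0) := by
    ext w D
    have hsplit (k : Fin K) : (if w k ∉ D then Real.log ε else a) =
        a + (Real.log ε - a) * if w k ∉ D then 1 else 0 := by
      split_ifs <;> ring
    simp_rw [hsplit, Finset.sum_add_distrib, ← Finset.mul_sum, Finset.sum_const, nsmul_eq_mul]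
    field_simp
  rw [hF, condExpectation_const_add_mul hM] at h
  change A.card * a + A.card * (Real.log ε - a) * c.missProb A ≤ _ at h
  have hl2 : Real.log 2 ≠ 0 := (Real.log_pos one_lt_two).ne'
  have heq : (n * L * Real.logb 2 (1 + A.card * P) / A.card
        - L * (1 - (A.card.choose 2 : ℝ) / M) * expLogDet n A.card μ / A.card) * Real.log 2 =
      (n * L * Real.log (1 + A.card * P) - L * ((1 - (A.card.choose 2 : ℝ) / M) *
        ∫ X : Fin n → Fin A.card → ℂ, logDet (Matrix.of X) ∂iidArray n A.card μ)) / A.card := by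
    rw [expLogDet_eq, Real.logb]
    field_simp
  rw [heq, le_div_iff₀ hk]
  linarith

theorem PMD_nonneg (act : PMF (Finset (Fin K))) : 0 ≤ c.PMD act := by
  refine expectation_nonneg fun A w D => ?_
  split_ifs
  · exact mul_nonneg (by positivity) (Finset.sum_nonneg fun k _ => by split_ifs <;> simp)
  · exact le_rfl

/-- At most `A.card` distinct messages are sent, so a list `D` has at least `D.card - A.card` wrong
entries. Counting an empty list as size 1 costs nothing, because `1 - A.card ≤ 0`. -/
theorem falseAlarm_le_condExpectation (hM : 1 ≤ M) {A : Finset (Fin K)} (hA : 1 ≤ A.card) :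
    max ((((max (c.listSize A.card) 1 : ℕ) : ℝ) - A.card) / (max (c.listSize A.card) 1 : ℕ)) 0 ≤
      c.condExpectation A fun w D => if 1 ≤ D.card then
        1 / (D.card : ℝ) * ∑ m ∈ D, (if m ∉ transmitted A w then 1 else 0) else 0 := by
  conv_lhs => rw [← condExpectation_const (c := c) hM A (max _ _)]
  refine condExpectation_mono fun w D hD => ?_
  have hnn : 0 ≤ 1 / (D.card : ℝ) * ∑ m ∈ D, (if m ∉ transmitted A w then (1 : ℝ) else 0) :=
    mul_nonneg (by positivity) (Finset.sum_nonneg fun k _ => by split_ifs <;> simp)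
  rcases Nat.eq_zero_or_pos (c.listSize A.card) with h | h
  · have hA' : (1 : ℝ) ≤ A.card := by exact_mod_cast hA
    refine (max_le (?_ : _ ≤ (0 : ℝ)) le_rfl).trans ?_
    · rw [h]
      simp [hA']
    · split_ifs
      · exact hnn
      · exact le_rfl
  · have hD1 : 1 ≤ D.card := hD ▸ h
    rw [if_pos hD1, max_eq_left (Nat.succ_le_of_lt h), ← hD]
    refine max_le ?_ hnn
    rw [div_eq_mul_inv, mul_comm, one_div]
    refine mul_le_mul_of_nonneg_left ?_ (by positivity)
    rw [Finset.sum_boole, sub_le_iff_le_add, ← Nat.cast_add]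
    have h1 : D.filter (fun m => m ∉ transmitted A w) = D \ transmitted A w := by
      ext m
      simp
    have h2 : (transmitted A w).card ≤ A.card := Finset.card_image_le
    have h3 := Finset.le_card_sdiff (transmitted A w) D
    rw [h1]
    exact_mod_cast (by omega : D.card ≤ (D \ transmitted A w).card + A.card)

theorem sum_falseAlarm_le_PFA (hM : 1 ≤ M) (act : PMF (Finset (Fin K))) {S : Finset ℕ}
    (hS : ∀ k ∈ S, 1 ≤ k) :
    ∑ k ∈ S, kaProb act k * max ((((max (c.listSize k) 1 : ℕ) : ℝ) - k) /
      (max (c.listSize k) 1 : ℕ)) 0 ≤ c.PFA act := by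
  rw [sum_kaProb_mul act S fun k => max ((((max (c.listSize k) 1 : ℕ) : ℝ) - k) /
    (max (c.listSize k) 1 : ℕ)) 0, PFA, expectation_eq]
  refine le_trans (Finset.sum_le_sum fun A hA => ?_) (Finset.sum_le_sum_of_subset_of_nonneg
    (Finset.filter_subset (fun A : Finset (Fin K) => A.card ∈ S) Finset.univ)
    fun A _ _ => mul_nonneg ENNReal.toReal_nonneg ?_)
  · exact mul_le_mul_of_nonneg_left
      (falseAlarm_le_condExpectation hM (hS _ (Finset.mem_filter.1 hA).2)) ENNReal.toReal_nonneg
  · refine mul_nonneg (by positivity) (Finset.sum_nonneg fun w _ => integral_nonneg fun ω => ?_)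
    simp only
    split_ifs
    · exact mul_nonneg (by positivity) (Finset.sum_nonneg fun k _ => by split_ifs <;> simp)
    · exact le_rfl

/-- The same list sizes serve both constraints and every `S`. They are raised to at least 1 so that
the score and `log Khat` make sense. -/
theorem fanoConstraint (hM : 2 ≤ M) {P : ℝ} (hP : 0 < P) (hμ : IsCenteredLaw μ P)
    {act : PMF (Finset (Fin K))} {εMD εFA : ℝ} (hε : εMD ≤ (M : ℝ) / (1 + M))
    (hMD : c.PMD act ≤ εMD) (hFA : c.PFA act ≤ εFA) {S : Finset ℕ} (hS : ∀ k ∈ S, 1 ≤ k) :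
    FanoConstraint n L M act μ εMD εFA P S fun k => max (c.listSize k) 1 := by
  have := hμ.prob
  have hM1 : 1 ≤ M := one_le_two.trans hM
  have hM0 : (0 : ℝ) < M := by exact_mod_cast hM1
  refine ⟨?_, (sum_falseAlarm_le_PFA hM1 act hS).trans hFA⟩
  have hl2 : 0 < Real.log 2 := Real.log_pos one_lt_two
  set T := Finset.univ.filter fun A : Finset (Fin K) => A.card ∈ S
  set R : ℕ → ℝ := fun k => n * L * Real.logb 2 (1 + k * P) / k
        - L * (1 - (k.choose 2 : ℝ) / M) * expLogDet n k μ / k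
  set σ : ℕ → ℕ := fun k => max (c.listSize k) 1
  have hmiss : ∑ A ∈ T, (act A).toReal * c.missProb A ≤ c.PMD act := sum_missProb_le_PMD act hS
  have hpos : ∀ ε : ℝ, 0 < ε → εMD ≤ ε → ε ≤ (M : ℝ) / (1 + M) →
      (∑ A ∈ T, (act A).toReal - ε) * Real.log M - Real.binEntropy ε
        - ∑ A ∈ T, (act A).toReal * Real.log (σ A.card) ≤
      ∑ A ∈ T, (act A).toReal * (R A.card * Real.log 2) := by
    intro ε h0 hle hε'
    have h1 : ε < 1 := hε'.trans_lt ((div_lt_one (by positivity)).2 (by linarith))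
    refine (sum_fano_le_sum_score T hM0 (fun A _ => ENNReal.toReal_nonneg)
      (fun A _ => missProb_nonneg (c := c) A)
      (s := fun A => (σ A.card : ℝ)) (fun A _ => by exact_mod_cast le_max_right _ _)
      (act.sum_toReal_le_one T) (hmiss.trans (hMD.trans hle)) h0 hε').trans ?_
    refine Finset.sum_le_sum fun A hA => mul_le_mul_of_nonneg_left ?_ ENNReal.toReal_nonneg
    exact score_missProb_le hM1 hP hμ (hS _ (Finset.mem_filter.1 hA).2) h0 h1
      (le_max_right _ _) (le_max_left _ _)
  have hε0 : 0 ≤ εMD := (PMD_nonneg act).trans hMD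
  have hmain : (∑ A ∈ T, (act A).toReal - εMD) * Real.log M - Real.binEntropy εMD
        - ∑ A ∈ T, (act A).toReal * Real.log (σ A.card) ≤
      ∑ A ∈ T, (act A).toReal * (R A.card * Real.log 2) := by
    rcases hε0.lt_or_eq with h | h
    · exact hpos εMD h le_rfl hε
    -- For `εMD = 0` the score is not available, as `log ε` would take the default value 0. The code
    -- also meets every larger tolerance, and the bound passes to the limit `ε ↓ 0` by continuity of
    -- the binary entropy.
    · have hcont : Continuous fun ε : ℝ => (∑ A ∈ T, (act A).toReal - ε) * Real.log M
          - Real.binEntropy ε - ∑ A ∈ T, (act A).toReal * Real.log (σ A.card) := by fun_prop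
      have hlim := (hcont.tendsto εMD).mono_left (nhdsWithin_le_nhds (s := Set.Ioi εMD))
      refine le_of_tendsto hlim ?_
      have hlt : εMD < (M : ℝ) / (1 + M) := by
        rw [← h]
        positivity
      filter_upwards [Ioc_mem_nhdsGT hlt] with ε hε'
      exact hpos ε (hε0.trans_lt hε'.1) hε'.1.le hε'.2
  have e1 : ∑ k ∈ S, kaProb act k = ∑ A ∈ T, (act A).toReal := by
    simpa using sum_kaProb_mul act S fun _ => 1
  have e2 := sum_kaProb_mul act S fun k => Real.logb 2 (σ k)
  have e3 := sum_kaProb_mul act S R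
  have e4 : ∑ A ∈ T, (act A).toReal * Real.logb 2 (σ A.card) =
      (∑ A ∈ T, (act A).toReal * Real.log (σ A.card)) / Real.log 2 := by
    simp_rw [Finset.sum_div, Real.logb, mul_div_assoc]
  have e5 : ∑ A ∈ T, (act A).toReal * (R A.card * Real.log 2) =
      (∑ A ∈ T, (act A).toReal * R A.card) * Real.log 2 := by
    simp_rw [Finset.sum_mul, mul_assoc]
  rw [e5, ← div_le_iff₀ hl2] at hmain
  change ((∑ k ∈ S, kaProb act k) - εMD) * Real.logb 2 M - h2 εMD
      - ∑ k ∈ S, kaProb act k * Real.logb 2 (σ k) ≤ ∑ k ∈ S, kaProb act k * R k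
  rw [e1, e2, e3, e4, h2_eq, Real.logb]
  rwa [sub_div, sub_div, mul_div_assoc] at hmain

end EnsembleCode

theorem theorem7 (K n L M : ℕ) (hK : 1 ≤ K) (hn : 1 ≤ n) (hL : 1 ≤ L) (hM : 2 ≤ M)
    (act : PMF (Finset (Fin K)))
    (μ : ℝ → Measure ℂ) (hμ : ∀ P : ℝ, 0 < P → IsCenteredLaw (μ P) P)
    (εMD εFA : ℝ) (hεMD : εMD ≤ (M : ℝ) / (1 + M)) :
    sInf ((fun P : ℝ => ((n * P / Real.logb 2 M : ℝ) : EReal)) ''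
        {P : ℝ | 0 < P ∧ ∀ S : Finset ℕ, S ⊆ Finset.Icc 1 K →
          ∃ Khat : ℕ → ℕ, (∀ k ∈ S, 1 ≤ Khat k ∧ Khat k ≤ K) ∧
            FanoConstraint n L M act (μ P) εMD εFA P S Khat})
      ≤ minEnergyPerBit.{u} K n L M act μ εMD εFA := by
  refine sInf_le_sInf (Set.image_mono ?_)
  rintro P ⟨hP, c, hMD, hFA⟩
  refine ⟨hP, fun S hS => ⟨fun k => max (c.listSize k) 1, fun k _ =>
    ⟨le_max_right _ _, max_le (c.listSize_le k) hK⟩, ?_⟩⟩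
  exact EnsembleCode.fanoConstraint hM hP (hμ P hP) hεMD hMD hFA
    fun k hk => (Finset.mem_Icc.1 (hS hk)).1
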